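/- **Proposition 2.7.** All manifolds are finite-dimensional, Hausdorff, second countable and without boundary, and all objects are of class $C^\infty$. Let $\iota:N\hookrightarrow M$ be an embedded submanifold with a normal bundle $\nu N$, i.e. a subbundle of $TM|_N$ with $TM|_N=TN\oplus\nu N$. Write $\mathrm{ann}(\nu N)\subseteq T^*M|_N$ for its annihilator, and call a vector field $X$ on $M$ *normal* if $X|_N\in\Gamma(\nu N)$. * A $k$-form $\kappa$ on $M$ is *soldered* to $(N,\nu N)$ if $\iota^*[i(X)\kappa]=0$ and $\iota^*[i(X)d\kappa]=0$ for every normal vector field $X$ (with $i(X)\kappa=0$ for $k=0$). $H^k_{sdeR}(M,N,\nu N)$ is the cohomology of the complex $(\Omega^\bullet(M,N,\nu N),d)$ of soldered forms. * A $k$-vector field $Q$ on $M$ is *soldered* to $(N,\nu N)$ if (for $k\ge1$) $i(\alpha_1\wedge\dots\wedge\alpha_{k-1})Q$ is tangent to $N$ for all $x\in N$ and $\alpha_1,\dots,\alpha_{k-1}\in\mathrm{ann}(\nu_xN)$, and $(L_XQ)|_{\mathrm{ann}(\nu N)}=0$ for every normal vector field $X$. * Let $\Pi$ be a Poisson bivector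 field on $M$ ($[\Pi,\Pi]=0$ for the Schouten–Nijenhuis bracket), with bracket $\{f,g\}=\Pi(df,dg)$, and let $\sharp_\Pi:T^*M\to TM$, $\beta(\sharp_\Pi\alpha)=\Pi(\alpha,\beta)$. Its extension to $k$-forms is $(\sharp_\Pi\kappa)(\beta_1,\dots,\beta_k)=(-1)^k\kappa(\sharp_\Pi\beta_1,\dots,\sharp_\Pi\beta_k)$. $(N,\nu N)$ is a *Dirac submanifold* of $(M,\Pi)$ if (i) $\sharp_\Pi(\mathrm{ann}(\nu N))\subseteq TN$, and (ii) every $x\in N$ has an open neighbourhood $U$ in $M$ such that for all $f,g\in C^\infty(U)$ with $df|_{\nu N}=0$ and $dg|_{\nu N}=0$ along $N\cap U$ one has $d\{f,g\}|_{\nu N}=0$ along $N\cap U$. * For a Dirac submanifold, $H^k_{sP}(M,N,\nu N)$ is the cohomology of the complex $(\mathcal V^\bullet(M,N,\nu N),\ \partial_\Pi=-[\Pi,\cdot\,])$ of soldered multivector fields. Let $(N,\nu N)$ be a Dirac submanifold of the Poisson manifold $(M,\Pi)$. Then for every $k\ge0$, $\sharp_\Pi$ sends soldered $d$-closed $k$-forms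 to soldered $\partial_\Pi$-closed $k$-vector fields, and $[\kappa]\mapsto[\sharp_\Pi\kappa]$ is a well-defined linear map $$\sharp_\Pi^k:H^k_{sdeR}(M,N,\nu N)\longrightarrow H^k_{sP}(M,N,\nu N).$$ If $\Pi$ is defined by a symplectic form $\omega$, i.e. $\omega(\sharp_\Pi\alpha,v)=-\alpha(v)$ for all $\alpha\in T_x^*M$, $v\in T_xM$ and $x\in M$, then every $\sharp_\Pi^k$ is an isomorphism. -/

import Mathlib

set_option maxSynthPendingDepth 3

open scoped Manifold ContDiff Topology
open Set

noncomputable section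

namespace SolderedPoisson

/-! ### Multivector fields on a finite-dimensional real vector space

A `k`-vector at a point of a space with tangent space `V` is an alternating `k`-linear form on
the dual of `V`, which is the standard identification in finite dimension. -/

section Flat

variable {E : Type*} [NormedAddCommGroup E] [NormedSpace ℝ E] {k : ℕ}

/-- The derivation of multivectors induced by a linear map `A` of the tangent space:
`(α₁, …, αₖ) ↦ ∑ⱼ Q(α₁, …, αⱼ ∘ A, …, αₖ)`, see `derivAction_apply`. -/
def derivAction (Q : (E →L[ℝ] ℝ) [⋀^Fin k]→L[ℝ] ℝ) :
    (E →L[ℝ] E) →L[ℝ] (E →L[ℝ] ℝ) [⋀^Fin k]→L[ℝ] ℝ :=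
  Q.fderivCompContinuousLinearMap (ContinuousLinearMap.id ℝ (E →L[ℝ] ℝ)) ∘L
    (ContinuousLinearMap.compL ℝ E E ℝ).flip

theorem derivAction_apply (Q : (E →L[ℝ] ℝ) [⋀^Fin k]→L[ℝ] ℝ) (A : E →L[ℝ] E)
    (α : Fin k → (E →L[ℝ] ℝ)) :
    derivAction Q A α = ∑ j, Q (Function.update α j (α j ∘L A)) := by
  simp only [derivAction, ContinuousLinearMap.comp_apply,
    ContinuousAlternatingMap.fderivCompContinuousLinearMap_apply]
  refine Finset.sum_congr rfl fun j _ => congrArg Q (funext fun i => ?_)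
  rcases eq_or_ne i j with rfl | h
  · simp
  · simp [h]

/-- Lie derivative `L_X Q = [X, Q]` of a `k`-vector field along a vector field:
on constant covectors, `(L_X Q)(α) = X(Q(α)) - ∑ⱼ Q(α₁, …, L_X αⱼ, …, αₖ)` with
`L_X αⱼ = αⱼ ∘ DX`. -/
def lieDerivFlat (X : E → E) (Q : E → (E →L[ℝ] ℝ) [⋀^Fin k]→L[ℝ] ℝ) (y : E) :
    (E →L[ℝ] ℝ) [⋀^Fin k]→L[ℝ] ℝ :=
  fderiv ℝ Q y (X y) - derivAction (Q y) (fderiv ℝ X y)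

variable [FiniteDimensional ℝ E]

/-- The canonical isomorphism of a finite-dimensional space with its double dual. -/
def bidualEquiv (E : Type*) [NormedAddCommGroup E] [NormedSpace ℝ E] [FiniteDimensional ℝ E] :
    E ≃L[ℝ] ((E →L[ℝ] ℝ) →L[ℝ] ℝ) :=
  (LinearEquiv.ofBijective (NormedSpace.inclusionInDoubleDual ℝ E).toLinearMap (by
    have hinj : Function.Injective (NormedSpace.inclusionInDoubleDual ℝ E).toLinearMap :=
      (NormedSpace.inclusionInDoubleDualLi (E := E) ℝ).injective
    refine ⟨hinj, (LinearMap.injective_iff_surjective_of_finrank_eq_finrank ?_).1 hinj⟩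
    have key : ∀ (V : Type _) [NormedAddCommGroup V] [NormedSpace ℝ V] [FiniteDimensional ℝ V],
        Module.finrank ℝ (V →L[ℝ] ℝ) = Module.finrank ℝ V := fun V _ _ _ =>
      (LinearEquiv.finrank_eq (LinearMap.toContinuousLinearMap (𝕜 := ℝ) (E := V)
        (F' := ℝ)).symm).trans Subspace.dual_finrank_eq
    exact ((key (E →L[ℝ] ℝ)).trans (key E)).symm)).toContinuousLinearEquiv

theorem apply_bidualEquiv_symm (φ : (E →L[ℝ] ℝ) →L[ℝ] ℝ) (β : E →L[ℝ] ℝ) :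
    β ((bidualEquiv E).symm φ) = φ β := by
  have h : bidualEquiv E ((bidualEquiv E).symm φ) β = φ β := by
    rw [ContinuousLinearEquiv.apply_symm_apply]
  exact h

/-- A bivector `P` as the linear map from covectors to vectors, `α ↦ P(α, ·)`. -/
def sharpFlat (P : (E →L[ℝ] ℝ) [⋀^Fin 2]→L[ℝ] ℝ) : (E →L[ℝ] ℝ) →L[ℝ] E :=
  (bidualEquiv E).symm.toContinuousLinearMap ∘L
    (ContinuousAlternatingMap.ofSubsingletonLIE (𝕜 := ℝ) (E := E →L[ℝ] ℝ) (F := ℝ)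
      (0 : Fin 1)).symm.toContinuousLinearEquiv.toContinuousLinearMap ∘L P.curryLeft

theorem apply_sharpFlat (P : (E →L[ℝ] ℝ) [⋀^Fin 2]→L[ℝ] ℝ) (α β : E →L[ℝ] ℝ) :
    β (sharpFlat P α) = P ![α, β] := by
  have h : β (sharpFlat P α) = P (Matrix.vecCons α fun _ => β) :=
    apply_bidualEquiv_symm (E := E) _ β
  rw [h]
  congr 1
  ext i
  fin_cases i <;> rfl

/-- Schouten-Nijenhuis bracket `[P, Q]` of a bivector field `P` with a `k`-vector field `Q`
(with the signs of a graded Lie algebra, and `[X, Q] = L_X Q` for vector fields `X`).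
On constant covectors, writing `Xᵢ = P(αᵢ, ·)`, it is given by the standard formula
`[P, Q](α₀, …, αₖ) = ∑ᵢ (-1)^i Xᵢ(Q(α₀, …, α̂ᵢ, …, αₖ))
  + ∑_{i < j} (-1)^(i + j) Q(d(P(αᵢ, αⱼ)), α₀, …, α̂ᵢ, …, α̂ⱼ, …, αₖ)`.
In the code the form `d(P(αᵢ, αⱼ)) = αⱼ ∘ DXᵢ` is put into the slot of `αⱼ`, and the sum runs over
ordered pairs `(i, j)` with `i ≠ j`, which counts each term of the second sum twice, with the
opposite sign. -/
def schoutenFlat (P : E → (E →L[ℝ] ℝ) [⋀^Fin 2]→L[ℝ] ℝ)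
    (Q : E → (E →L[ℝ] ℝ) [⋀^Fin k]→L[ℝ] ℝ) (y : E) :
    (E →L[ℝ] ℝ) [⋀^Fin (k + 1)]→L[ℝ] ℝ :=
  .alternatizeUncurryFin (fderiv ℝ Q y ∘L sharpFlat (P y)) -
    (1 / 2 : ℝ) • .alternatizeUncurryFin
      (derivAction (Q y) ∘L (fderiv ℝ (fun z => sharpFlat (P z)) y).flip)

theorem schoutenFlat_apply (P : E → (E →L[ℝ] ℝ) [⋀^Fin 2]→L[ℝ] ℝ)
    (Q : E → (E →L[ℝ] ℝ) [⋀^Fin k]→L[ℝ] ℝ) (y : E) (α : Fin (k + 1) → (E →L[ℝ] ℝ)) :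
    schoutenFlat P Q y α = ∑ i : Fin (k + 1), (-1 : ℝ) ^ (i : ℕ) *
      (fderiv ℝ Q y (sharpFlat (P y) (α i)) (i.removeNth α) -
        1 / 2 * ∑ j : Fin k, Q y (Function.update (i.removeNth α) j
          (i.removeNth α j ∘L (fderiv ℝ (fun z => sharpFlat (P z)) y).flip (α i)))) := by
  simp only [schoutenFlat, ContinuousAlternatingMap.sub_apply, ContinuousAlternatingMap.smul_apply,
    ContinuousAlternatingMap.alternatizeUncurryFin_apply, derivAction_apply,
    ContinuousLinearMap.comp_apply]
  rw [Finset.smul_sum, ← Finset.sum_sub_distrib]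
  refine Finset.sum_congr rfl fun i _ => ?_
  rw [mul_sub, Finset.mul_sum, Finset.mul_sum, Finset.smul_sum]
  simp only [zsmul_eq_mul, smul_eq_mul]
  push_cast
  rw [← Finset.mul_sum, ← Finset.mul_sum, ← Finset.mul_sum]
  ring

end Flat

/-! ### Forms and multivector fields on a manifold -/

section Manifold

variable {E : Type*} [NormedAddCommGroup E] [NormedSpace ℝ E]
  {M : Type*} [TopologicalSpace M] [ChartedSpace E M] {k : ℕ}

variable (E) in
/-- Tangent space of a manifold modelled on `E`. -/
abbrev Tan (x : M) : Type _ := TangentSpace 𝓘(ℝ, E) x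

variable (E) in
/-- Cotangent space of a manifold modelled on `E`. -/
abbrev Cotan (x : M) : Type _ := Tan E x →L[ℝ] ℝ

variable (E M) in
/-- (Not necessarily smooth) differential `k`-forms on `M`. -/
abbrev DForm (k : ℕ) : Type _ := ∀ x : M, (Tan E x) [⋀^Fin k]→L[ℝ] ℝ

variable (E M) in
/-- (Not necessarily smooth) `k`-vector fields on `M`. -/
abbrev MVField (k : ℕ) : Type _ := ∀ x : M, (Cotan E x) [⋀^Fin k]→L[ℝ] ℝ

/-- Derivative of the preferred chart at `x₀`, at the point `x` of its source
(where it is invertible). -/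
def chartDeriv (x₀ x : M) : Tan E x →L[ℝ] E :=
  mfderiv 𝓘(ℝ, E) 𝓘(ℝ, E) (extChartAt 𝓘(ℝ, E) x₀) x

/-- Coordinate expression of a form in the preferred chart at `x₀`. -/
def DForm.inChart (κ : DForm E M k) (x₀ : M) (y : E) : E [⋀^Fin k]→L[ℝ] ℝ :=
  (κ ((extChartAt 𝓘(ℝ, E) x₀).symm y)).compContinuousLinearMap
    (chartDeriv x₀ ((extChartAt 𝓘(ℝ, E) x₀).symm y)).inverse

/-- Coordinate expression of a multivector field in the preferred chart at `x₀`. -/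
def MVField.inChart (Q : MVField E M k) (x₀ : M) (y : E) : (E →L[ℝ] ℝ) [⋀^Fin k]→L[ℝ] ℝ :=
  (Q ((extChartAt 𝓘(ℝ, E) x₀).symm y)).compContinuousLinearMap
    ((chartDeriv x₀ ((extChartAt 𝓘(ℝ, E) x₀).symm y)).precomp ℝ)

/-- Coordinate expression of a vector field in the preferred chart at `x₀`. -/
def vectorInChart (X : ∀ x : M, Tan E x) (x₀ : M) (y : E) : E :=
  chartDeriv x₀ ((extChartAt 𝓘(ℝ, E) x₀).symm y) (X ((extChartAt 𝓘(ℝ, E) x₀).symm y))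

/-- A form is smooth if all its coordinate expressions are. -/
def DForm.IsSmooth (κ : DForm E M k) : Prop :=
  ∀ x₀ : M, ContDiffOn ℝ ∞ (DForm.inChart κ x₀) (extChartAt 𝓘(ℝ, E) x₀).target

/-- A multivector field is smooth if all its coordinate expressions are. -/
def MVField.IsSmooth (Q : MVField E M k) : Prop :=
  ∀ x₀ : M, ContDiffOn ℝ ∞ (MVField.inChart Q x₀) (extChartAt 𝓘(ℝ, E) x₀).target

/-- A vector field is smooth if it is a smooth section of the tangent bundle. -/
def IsSmoothVectorField [IsManifold 𝓘(ℝ, E) ∞ M] (X : ∀ x : M, Tan E x) : Prop :=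
  ContMDiff 𝓘(ℝ, E) (𝓘(ℝ, E).tangent) ∞ fun x => (⟨x, X x⟩ : TangentBundle 𝓘(ℝ, E) M)

/-- Exterior derivative, computed at `x` in the preferred chart at `x`. -/
def extD (κ : DForm E M k) : DForm E M (k + 1) := fun x =>
  (extDeriv (DForm.inChart κ x) (extChartAt 𝓘(ℝ, E) x x)).compContinuousLinearMap (chartDeriv x x)

/-- Lie derivative `L_X Q` of a multivector field, computed at `x` in the preferred chart at `x`. -/
def lieDeriv (X : ∀ x : M, Tan E x) (Q : MVField E M k) : MVField E M k :=
  fun x => (lieDerivFlat (vectorInChart X x) (MVField.inChart Q x)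
    (extChartAt 𝓘(ℝ, E) x x)).compContinuousLinearMap ((chartDeriv x x).inverse.precomp ℝ)

/-- Schouten-Nijenhuis bracket `[P, Q]` of a bivector field with a multivector field, computed at
`x` in the preferred chart at `x`. -/
def schouten [FiniteDimensional ℝ E] (P : MVField E M 2) (Q : MVField E M k) :
    MVField E M (k + 1) :=
  fun x => (schoutenFlat (MVField.inChart P x) (MVField.inChart Q x)
    (extChartAt 𝓘(ℝ, E) x x)).compContinuousLinearMap ((chartDeriv x x).inverse.precomp ℝ)

/-- A Poisson bivector field: smooth, with `[P, P] = 0`. -/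
structure IsPoisson [FiniteDimensional ℝ E] (P : MVField E M 2) : Prop where
  smooth : MVField.IsSmooth P
  schouten_self : schouten P P = 0

/-- The Lichnerowicz-Poisson coboundary `∂_P = -[P, ·]`. -/
def poissonD [FiniteDimensional ℝ E] (P : MVField E M 2) (Q : MVField E M k) :
    MVField E M (k + 1) :=
  -schouten P Q

/-- The morphism `♯_P : T*M → TM`, `β(♯_P α) = P(α, β)`. -/
def sharp [FiniteDimensional ℝ E] (P : MVField E M 2) (x : M) : Cotan E x →L[ℝ] Tan E x :=
  sharpFlat (E := E) (P x)

theorem apply_sharp [FiniteDimensional ℝ E] (P : MVField E M 2) (x : M) (α β : Cotan E x) :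
    β (sharp P x α) = P x ![α, β] :=
  apply_sharpFlat (E := E) (P x) α β

/-- The extension of `♯_P` to exterior powers. As `β(♯_P α) = -α(♯_P β)`, the `k`-vector
`♯_P α₁ ∧ … ∧ ♯_P αₖ` is obtained from the form `α₁ ∧ … ∧ αₖ` by
`(♯_P κ)(β₁, …, βₖ) = (-1)^k κ(♯_P β₁, …, ♯_P βₖ)`. -/
def sharpForm [FiniteDimensional ℝ E] (P : MVField E M 2) (κ : DForm E M k) : MVField E M k :=
  fun x => (-1 : ℝ) ^ k • (κ x).compContinuousLinearMap (sharp P x)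

/-- The differential of a function, as a covector. -/
def dAt (f : M → ℝ) (x : M) : Cotan E x := mfderiv 𝓘(ℝ, E) 𝓘(ℝ, ℝ) f x

/-- The Poisson bracket of functions, `{f, g} = P(df, dg)`. -/
def poissonBracket (P : MVField E M 2) (f g : M → ℝ) (x : M) : ℝ :=
  P x ![dAt f x, dAt g x]

/-- A symplectic form: a smooth closed nondegenerate `2`-form. -/
structure IsSymplectic (Ω : DForm E M 2) : Prop where
  smooth : DForm.IsSmooth Ω
  closed : extD Ω = 0
  nondegenerate : ∀ (x : M) (v : Tan E x), (∀ w : Tan E x, Ω x ![v, w] = 0) → v = 0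

/-- `P` is the bivector field of the symplectic form `Ω`: `♯_P` is inverse to `-♭_Ω`,
where `♭_Ω v = Ω(v, ·)`. -/
def IsDefinedBy [FiniteDimensional ℝ E] (P : MVField E M 2) (Ω : DForm E M 2) : Prop :=
  ∀ (x : M) (α : Cotan E x) (v : Tan E x), Ω x ![sharp P x α, v] = -α v

/-- Contraction `i(v)κ` with a vector in the first slot; it vanishes on `0`-forms. -/
def contract {V : Type*} [AddCommGroup V] [Module ℝ V] [TopologicalSpace V] (v : V) :
    ∀ {k : ℕ}, V [⋀^Fin k]→L[ℝ] ℝ → V [⋀^Fin (k - 1)]→ₗ[ℝ] ℝ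
  | 0, _ => 0
  | _ + 1, κ => κ.toAlternatingMap.curryLeft v

end Manifold

/-! ### Linearity of the operations -/

section Linearity

variable {E : Type*} [NormedAddCommGroup E] [NormedSpace ℝ E]
  {M : Type*} [TopologicalSpace M] [ChartedSpace E M] {k : ℕ}

theorem inChart_add (κ κ' : DForm E M k) (x : M) :
    DForm.inChart (κ + κ') x = DForm.inChart κ x + DForm.inChart κ' x := rfl

theorem inChart_smul (c : ℝ) (κ : DForm E M k) (x : M) :
    DForm.inChart (c • κ) x = c • DForm.inChart κ x := rfl

theorem inChart_zero (x : M) : DForm.inChart (0 : DForm E M k) x = 0 := rfl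

theorem mvInChart_add (Q Q' : MVField E M k) (x : M) :
    MVField.inChart (Q + Q') x = MVField.inChart Q x + MVField.inChart Q' x := rfl

theorem mvInChart_smul (c : ℝ) (Q : MVField E M k) (x : M) :
    MVField.inChart (c • Q) x = c • MVField.inChart Q x := rfl

theorem mvInChart_zero (x : M) : MVField.inChart (0 : MVField E M k) x = 0 := rfl

theorem DForm.IsSmooth.differentiableAt {κ : DForm E M k} (h : DForm.IsSmooth κ) (x : M) :
    DifferentiableAt ℝ (DForm.inChart κ x) (extChartAt 𝓘(ℝ, E) x x) :=
  ((h x).contDiffAt ((isOpen_extChartAt_target x).mem_nhds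
    (mem_extChartAt_target x))).differentiableAt (by simp)

theorem MVField.IsSmooth.differentiableAt {Q : MVField E M k} (h : MVField.IsSmooth Q) (x : M) :
    DifferentiableAt ℝ (MVField.inChart Q x) (extChartAt 𝓘(ℝ, E) x x) :=
  ((h x).contDiffAt ((isOpen_extChartAt_target x).mem_nhds
    (mem_extChartAt_target x))).differentiableAt (by simp)

theorem extD_add {κ κ' : DForm E M k} (h : DForm.IsSmooth κ) (h' : DForm.IsSmooth κ') :
    extD (κ + κ') = extD κ + extD κ' := by
  funext x
  ext v
  simp only [extD, inChart_add, extDeriv_add (h.differentiableAt x) (h'.differentiableAt x)]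
  rfl

theorem extD_smul (c : ℝ) (κ : DForm E M k) : extD (c • κ) = c • extD κ := by
  funext x
  ext v
  simp only [extD, inChart_smul, extDeriv_smul]
  rfl

theorem extD_zero : extD (0 : DForm E M k) = 0 := by
  simpa using extD_smul (0 : ℝ) (0 : DForm E M k)

theorem derivAction_add (Q Q' : (E →L[ℝ] ℝ) [⋀^Fin k]→L[ℝ] ℝ) :
    derivAction (Q + Q') = derivAction Q + derivAction Q' := by
  ext A α
  simp [derivAction_apply, Finset.sum_add_distrib]

theorem derivAction_smul (c : ℝ) (Q : (E →L[ℝ] ℝ) [⋀^Fin k]→L[ℝ] ℝ) :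
    derivAction (c • Q) = c • derivAction Q := by
  ext A α
  simp [derivAction_apply, Finset.mul_sum]

theorem contract_add {V : Type*} [AddCommGroup V] [Module ℝ V] [TopologicalSpace V]
    (v : V) (κ κ' : V [⋀^Fin k]→L[ℝ] ℝ) : contract v (κ + κ') = contract v κ + contract v κ' := by
  cases k
  · simp [contract]
  · rfl

theorem contract_smul {V : Type*} [AddCommGroup V] [Module ℝ V] [TopologicalSpace V]
    (v : V) (c : ℝ) (κ : V [⋀^Fin k]→L[ℝ] ℝ) : contract v (c • κ) = c • contract v κ := by
  cases k
  · simp [contract]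
  · rfl

theorem isSmooth_zero : MVField.IsSmooth (0 : MVField E M k) := fun x => by
  rw [mvInChart_zero]
  exact contDiffOn_const

theorem eq_zero_of_forall_cotan {x : M} (v : Tan E x) (h : ∀ β : Cotan E x, β v = 0) : v = 0 :=
  SeparatingDual.eq_zero_of_forall_dual_eq_zero (R := ℝ) (V := E) h

theorem lieDeriv_add (X : ∀ x : M, Tan E x) {Q Q' : MVField E M k} (h : MVField.IsSmooth Q)
    (h' : MVField.IsSmooth Q') : lieDeriv X (Q + Q') = lieDeriv X Q + lieDeriv X Q' := by
  have key : ∀ x : M, lieDerivFlat (vectorInChart X x) (MVField.inChart (Q + Q') x)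
      (extChartAt 𝓘(ℝ, E) x x) = lieDerivFlat (vectorInChart X x) (MVField.inChart Q x)
      (extChartAt 𝓘(ℝ, E) x x) + lieDerivFlat (vectorInChart X x) (MVField.inChart Q' x)
      (extChartAt 𝓘(ℝ, E) x x) := fun x => by
    rw [mvInChart_add, lieDerivFlat, fderiv_add (h.differentiableAt x) (h'.differentiableAt x),
      Pi.add_apply, derivAction_add, lieDerivFlat, lieDerivFlat]
    rw [add_apply, add_apply]
    abel
  funext x
  simp only [lieDeriv, key]
  rfl

theorem lieDeriv_smul (X : ∀ x : M, Tan E x) (c : ℝ) {Q : MVField E M k}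
    (h : MVField.IsSmooth Q) : lieDeriv X (c • Q) = c • lieDeriv X Q := by
  have key : ∀ x : M, lieDerivFlat (vectorInChart X x) (MVField.inChart (c • Q) x)
      (extChartAt 𝓘(ℝ, E) x x) = c • lieDerivFlat (vectorInChart X x) (MVField.inChart Q x)
      (extChartAt 𝓘(ℝ, E) x x) := fun x => by
    rw [mvInChart_smul, lieDerivFlat, fderiv_const_smul (h.differentiableAt x),
      Pi.smul_apply, derivAction_smul, lieDerivFlat, smul_sub]
    rfl
  funext x
  simp only [lieDeriv, key]
  rfl

variable [FiniteDimensional ℝ E]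

theorem schouten_add (P : MVField E M 2) {Q Q' : MVField E M k} (h : MVField.IsSmooth Q)
    (h' : MVField.IsSmooth Q') : schouten P (Q + Q') = schouten P Q + schouten P Q' := by
  have key : ∀ x : M, schoutenFlat (MVField.inChart P x) (MVField.inChart (Q + Q') x)
      (extChartAt 𝓘(ℝ, E) x x) = schoutenFlat (MVField.inChart P x) (MVField.inChart Q x)
      (extChartAt 𝓘(ℝ, E) x x) + schoutenFlat (MVField.inChart P x) (MVField.inChart Q' x)
      (extChartAt 𝓘(ℝ, E) x x) := fun x => by
    rw [mvInChart_add, schoutenFlat,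
      fderiv_add (h.differentiableAt x) (h'.differentiableAt x),
      Pi.add_apply, derivAction_add, schoutenFlat, schoutenFlat, ContinuousLinearMap.add_comp,
      ContinuousLinearMap.add_comp, ContinuousAlternatingMap.alternatizeUncurryFin_add,
      ContinuousAlternatingMap.alternatizeUncurryFin_add, smul_add]
    abel
  funext x
  simp only [schouten, key]
  rfl

theorem schouten_smul (P : MVField E M 2) (c : ℝ) {Q : MVField E M k}
    (h : MVField.IsSmooth Q) : schouten P (c • Q) = c • schouten P Q := by
  have key : ∀ x : M, schoutenFlat (MVField.inChart P x) (MVField.inChart (c • Q) x)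
      (extChartAt 𝓘(ℝ, E) x x) = c • schoutenFlat (MVField.inChart P x) (MVField.inChart Q x)
      (extChartAt 𝓘(ℝ, E) x x) := fun x => by
    rw [mvInChart_smul, schoutenFlat, fderiv_const_smul (h.differentiableAt x),
      Pi.smul_apply, derivAction_smul, schoutenFlat, ContinuousLinearMap.smul_comp,
      ContinuousLinearMap.smul_comp, ContinuousAlternatingMap.alternatizeUncurryFin_smul,
      ContinuousAlternatingMap.alternatizeUncurryFin_smul, smul_sub, smul_comm c (1 / 2 : ℝ)]
  funext x
  simp only [schouten, key]
  rfl

theorem poissonD_add (P : MVField E M 2) {Q Q' : MVField E M k} (h : MVField.IsSmooth Q)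
    (h' : MVField.IsSmooth Q') : poissonD P (Q + Q') = poissonD P Q + poissonD P Q' := by
  rw [poissonD, schouten_add P h h', neg_add, poissonD, poissonD]

theorem poissonD_smul (P : MVField E M 2) (c : ℝ) {Q : MVField E M k}
    (h : MVField.IsSmooth Q) : poissonD P (c • Q) = c • poissonD P Q := by
  rw [poissonD, schouten_smul P c h, poissonD, smul_neg]

theorem poissonD_zero (P : MVField E M 2) : poissonD P (0 : MVField E M k) = 0 := by
  simpa using poissonD_smul P (0 : ℝ) (isSmooth_zero (E := E) (M := M) (k := k))

theorem exists_vectorFlat {n : ℕ} (Q : (E →L[ℝ] ℝ) [⋀^Fin (n + 1)]→L[ℝ] ℝ)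
    (α : Fin n → (E →L[ℝ] ℝ)) :
    ∃ u : E, ∀ β : E →L[ℝ] ℝ, β u = Q (Fin.snoc (α := fun _ => E →L[ℝ] ℝ) α β) := by
  refine ⟨(bidualEquiv E).symm
    (Q.toContinuousLinearMap (Fin.snoc (α := fun _ => E →L[ℝ] ℝ) α 0) (Fin.last n)), fun β => ?_⟩
  rw [apply_bidualEquiv_symm]
  exact congrArg Q (Fin.update_snoc_last (α := fun _ => E →L[ℝ] ℝ) ..)

theorem exists_vector {n : ℕ} {x : M} (Q : (Cotan E x) [⋀^Fin (n + 1)]→L[ℝ] ℝ)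
    (α : Fin n → Cotan E x) :
    ∃ u : Tan E x, ∀ β : Cotan E x, β u = Q (Fin.snoc (α := fun _ => Cotan E x) α β) :=
  exists_vectorFlat (E := E) Q α

end Linearity

/-! ### Normalized submanifolds, soldered forms and multivector fields, cohomology -/

section Soldered

variable {E : Type*} [NormedAddCommGroup E] [NormedSpace ℝ E] [FiniteDimensional ℝ E]
  {F : Type*} [NormedAddCommGroup F] [NormedSpace ℝ F]
  {M : Type*} [TopologicalSpace M] [ChartedSpace E M] [IsManifold 𝓘(ℝ, E) ∞ M]
  {N : Type*} [TopologicalSpace N] [ChartedSpace F N]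
  {k : ℕ}

variable (E F) in
/-- The differential `T_pN → T_{ι p}M` of `ι`. -/
def diffAt (ι : N → M) (p : N) : TangentSpace 𝓘(ℝ, F) p →L[ℝ] Tan E (ι p) :=
  mfderiv 𝓘(ℝ, F) 𝓘(ℝ, E) ι p

variable (E F) in
/-- The tangent space `T_pN`, as a subspace of `T_{ι p}M`. -/
def tangentOf (ι : N → M) (p : N) : Submodule ℝ (Tan E (ι p)) :=
  LinearMap.range (diffAt E F ι p).toLinearMap

variable (F) in
/-- `ν` is a normal bundle of the submanifold `ι : N → M`: a smooth subbundle of `TM|_N`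
with `TM|_N = TN ⊕ ν`. -/
structure IsNormalBundle (ι : N → M) (ν : ∀ p : N, Submodule ℝ (Tan E (ι p))) : Prop where
  isCompl : ∀ p : N, IsCompl (tangentOf E F ι p) (ν p)
  smooth : ∀ p₀ : N, ∃ U : Set N, IsOpen U ∧ p₀ ∈ U ∧
    ∃ (r : ℕ) (Y : Fin r → ∀ p : N, Tan E (ι p)),
      (∀ a, ContMDiffOn 𝓘(ℝ, F) (𝓘(ℝ, E).tangent) ∞
        (fun p => (⟨ι p, Y a p⟩ : TangentBundle 𝓘(ℝ, E) M)) U) ∧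
      ∀ p ∈ U, LinearIndependent ℝ (fun a => Y a p) ∧
        Submodule.span ℝ (range fun a => Y a p) = ν p

/-- The vector field `X` on `M` is normal to `N`: `X|_N ∈ Γ(ν)`. -/
def IsNormalTo {ι : N → M} (ν : ∀ p : N, Submodule ℝ (Tan E (ι p)))
    (X : ∀ x : M, Tan E x) : Prop :=
  IsSmoothVectorField X ∧ ∀ p : N, X (ι p) ∈ ν p

/-- The annihilator of the normal space `ν_p`. -/
def annNormal {ι : N → M} (ν : ∀ p : N, Submodule ℝ (Tan E (ι p))) (p : N) :
    Submodule ℝ (Cotan E (ι p)) where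
  carrier := {α | ∀ w ∈ ν p, α w = 0}
  add_mem' := fun {α β} hα hβ w hw => by simp [hα w hw, hβ w hw]
  zero_mem' := fun w _ => rfl
  smul_mem' := fun c α hα w hw => by simp [hα w hw]

variable (F) in
/-- `(N, ν)` is a Dirac submanifold of `(M, P)`: `♯_P(ann ν) ⊆ TN`, and each point of `N` has an
open neighbourhood `U` in `M` such that `df|_ν = 0` and `dg|_ν = 0` imply `d{f, g}|_ν = 0`
for all `f, g ∈ C^∞(U)`. -/
structure IsDirac (P : MVField E M 2) (ι : N → M) (ν : ∀ p : N, Submodule ℝ (Tan E (ι p))) :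
    Prop where
  sharp_mem : ∀ p : N, ∀ α ∈ annNormal ν p, sharp P (ι p) α ∈ tangentOf E F ι p
  bracket : ∀ p : N, ∃ U : Set M, IsOpen U ∧ ι p ∈ U ∧ ∀ f g : M → ℝ,
    ContMDiffOn 𝓘(ℝ, E) 𝓘(ℝ, ℝ) ∞ f U → ContMDiffOn 𝓘(ℝ, E) 𝓘(ℝ, ℝ) ∞ g U →
    (∀ q : N, ι q ∈ U → dAt f (ι q) ∈ annNormal ν q) →
    (∀ q : N, ι q ∈ U → dAt g (ι q) ∈ annNormal ν q) →
    ∀ q : N, ι q ∈ U → dAt (poissonBracket P f g) (ι q) ∈ annNormal ν q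

variable (F) in
/-- The smooth `k`-form `κ` is soldered to `(N, ν)`: `ι^*[i(X)κ] = 0` and `ι^*[i(X)dκ] = 0` for all
vector fields `X` normal to `N`. -/
structure IsSolderedForm (ι : N → M) (ν : ∀ p : N, Submodule ℝ (Tan E (ι p)))
    (κ : DForm E M k) : Prop where
  smooth : DForm.IsSmooth κ
  contract_eq : ∀ X : ∀ x : M, Tan E x, IsNormalTo ν X → ∀ p : N,
    (contract (X (ι p)) (κ (ι p))).compLinearMap (diffAt E F ι p).toLinearMap = 0
  contract_extD_eq : ∀ X : ∀ x : M, Tan E x, IsNormalTo ν X → ∀ p : N,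
    (contract (X (ι p)) (extD κ (ι p))).compLinearMap (diffAt E F ι p).toLinearMap = 0

variable (F) in
/-- The vectors `i(α₁ ∧ … ∧ αₖ₋₁)Q`, i.e. the `v` with `β(v) = Q(α₁, …, αₖ₋₁, β)` for all `β`, are
tangent to `N` for all `αᵢ ∈ ann ν`. There is no condition on functions. -/
def IsTangentAlong (ι : N → M) (ν : ∀ p : N, Submodule ℝ (Tan E (ι p))) :
    ∀ {k : ℕ}, MVField E M k → Prop
  | 0, _ => True
  | n + 1, Q => ∀ (p : N) (α : Fin n → Cotan E (ι p)), (∀ i, α i ∈ annNormal ν p) →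
      ∀ v : Tan E (ι p),
        (∀ β : Cotan E (ι p), β v = Q (ι p) (Fin.snoc (α := fun _ => Cotan E (ι p)) α β)) →
        v ∈ tangentOf E F ι p

variable (F) in
/-- The smooth `k`-vector field `Q` is soldered to `(N, ν)`: `i(λ)Q|_N` is tangent to `N` for all
`λ ∈ ∧^{k-1} ann ν`, and `(L_X Q)|_{ann ν} = 0` for all vector fields `X` normal to `N`. -/
structure IsSolderedMV (ι : N → M) (ν : ∀ p : N, Submodule ℝ (Tan E (ι p)))
    (Q : MVField E M k) : Prop where
  smooth : MVField.IsSmooth Q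
  tangent : IsTangentAlong F ι ν Q
  lieDeriv_eq : ∀ X : ∀ x : M, Tan E x, IsNormalTo ν X → ∀ (p : N) (α : Fin k → Cotan E (ι p)),
    (∀ i, α i ∈ annNormal ν p) → lieDeriv X Q (ι p) α = 0

variable (F) in
/-- The space `Ω^k(M, N, ν)` of soldered `k`-forms. -/
def solderedForms (ι : N → M) (ν : ∀ p : N, Submodule ℝ (Tan E (ι p))) (k : ℕ) :
    Submodule ℝ (DForm E M k) where
  carrier := {κ | IsSolderedForm F ι ν κ}
  add_mem' := fun {κ κ'} h h' =>
    { smooth := fun x => (h.smooth x).add (h'.smooth x)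
      contract_eq := fun X hX p => by
        rw [Pi.add_apply, contract_add]
        exact (congrArg₂ (· + ·) (h.contract_eq X hX p) (h'.contract_eq X hX p)).trans (add_zero _)
      contract_extD_eq := fun X hX p => by
        rw [extD_add h.smooth h'.smooth, Pi.add_apply, contract_add]
        exact (congrArg₂ (· + ·) (h.contract_extD_eq X hX p)
          (h'.contract_extD_eq X hX p)).trans (add_zero _) }
  zero_mem' :=
    { smooth := fun x => by
        rw [inChart_zero]
        exact contDiffOn_const
      contract_eq := fun X _ p => by
        have h : contract (X (ι p)) ((0 : DForm E M k) (ι p)) = 0 := by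
          simpa using contract_smul (X (ι p)) (0 : ℝ) ((0 : DForm E M k) (ι p))
        rw [h]
        rfl
      contract_extD_eq := fun X _ p => by
        have h : contract (X (ι p)) (extD (0 : DForm E M k) (ι p)) = 0 := by
          rw [extD_zero]
          simpa using contract_smul (X (ι p)) (0 : ℝ) ((0 : DForm E M (k + 1)) (ι p))
        rw [h]
        rfl }
  smul_mem' := fun c κ h =>
    { smooth := fun x => (h.smooth x).const_smul c
      contract_eq := fun X hX p => by
        rw [Pi.smul_apply, contract_smul]
        exact (congrArg (c • ·) (h.contract_eq X hX p)).trans (smul_zero _)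
      contract_extD_eq := fun X hX p => by
        rw [extD_smul, Pi.smul_apply, contract_smul]
        exact (congrArg (c • ·) (h.contract_extD_eq X hX p)).trans (smul_zero _) }

theorem isSolderedMV_zero {ι : N → M} {ν : ∀ p : N, Submodule ℝ (Tan E (ι p))} :
    IsSolderedMV F ι ν (0 : MVField E M k) where
  smooth := isSmooth_zero
  tangent := by
    cases k with
    | zero => trivial
    | succ n =>
      intro p α hα v hv
      rw [eq_zero_of_forall_cotan v fun β => hv β]
      exact zero_mem _
  lieDeriv_eq := fun X _ p α _ => by
    have h : lieDeriv X (0 : MVField E M k) = 0 := by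
      simpa using lieDeriv_smul X (0 : ℝ) (isSmooth_zero (E := E) (M := M) (k := k))
    rw [h]
    rfl

theorem isTangentAlong_smul {c : ℝ} (hc : c ≠ 0) {ι : N → M}
    {ν : ∀ p : N, Submodule ℝ (Tan E (ι p))}
    {Q : MVField E M k} (h : IsTangentAlong F ι ν Q) : IsTangentAlong F ι ν (c • Q) := by
  cases k with
  | zero => trivial
  | succ n =>
    intro p α hα v hv
    have h2 := h p α hα (c⁻¹ • v) fun β => by
      rw [map_smul, hv β, Pi.smul_apply, ContinuousAlternatingMap.smul_apply, smul_smul,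
        inv_mul_cancel₀ hc, one_smul]
    have h3 := (tangentOf E F ι p).smul_mem c h2
    rwa [smul_smul, mul_inv_cancel₀ hc, one_smul] at h3

theorem isTangentAlong_add {ι : N → M} {ν : ∀ p : N, Submodule ℝ (Tan E (ι p))}
    {Q Q' : MVField E M k} (h : IsTangentAlong F ι ν Q) (h' : IsTangentAlong F ι ν Q') :
    IsTangentAlong F ι ν (Q + Q') := by
  cases k with
  | zero => trivial
  | succ n =>
    intro p α hα v hv
    obtain ⟨u, hu⟩ : ∃ u : Tan E (ι p), ∀ β : Cotan E (ι p),
        β u = Q (ι p) (Fin.snoc (α := fun _ => Cotan E (ι p)) α β) :=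
      exists_vector (Q (ι p)) α
    have h2 := h' p α hα (v - u) fun β => by
      rw [map_sub, hv β, hu β, Pi.add_apply, ContinuousAlternatingMap.add_apply]
      ring
    simpa using (tangentOf E F ι p).add_mem h2 (h p α hα u hu)

variable (F) in
/-- The space `𝒱^k(M, N, ν)` of soldered `k`-vector fields. -/
def solderedMVFields (ι : N → M) (ν : ∀ p : N, Submodule ℝ (Tan E (ι p))) (k : ℕ) :
    Submodule ℝ (MVField E M k) where
  carrier := {Q | IsSolderedMV F ι ν Q}
  add_mem' := fun {Q Q'} h h' =>
    { smooth := fun x => (h.smooth x).add (h'.smooth x)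
      tangent := isTangentAlong_add h.tangent h'.tangent
      lieDeriv_eq := fun X hX p α hα => by
        rw [lieDeriv_add X h.smooth h'.smooth, Pi.add_apply, ContinuousAlternatingMap.add_apply,
          h.lieDeriv_eq X hX p α hα, h'.lieDeriv_eq X hX p α hα, add_zero] }
  zero_mem' := isSolderedMV_zero
  smul_mem' := fun c Q h => by
    rcases eq_or_ne c 0 with rfl | hc
    · rw [zero_smul]
      exact isSolderedMV_zero
    · exact
      { smooth := fun x => (h.smooth x).const_smul c
        tangent := isTangentAlong_smul hc h.tangent
        lieDeriv_eq := fun X hX p α hα => by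
          rw [lieDeriv_smul X c h.smooth, Pi.smul_apply, ContinuousAlternatingMap.smul_apply,
            h.lieDeriv_eq X hX p α hα, smul_zero] }

variable (F) in
/-- Soldered `k`-forms `κ` with `dκ = 0`. -/
def deRhamCocycles (ι : N → M) (ν : ∀ p : N, Submodule ℝ (Tan E (ι p))) (k : ℕ) :
    Submodule ℝ (DForm E M k) where
  carrier := {κ | κ ∈ solderedForms F ι ν k ∧ extD κ = 0}
  add_mem' := fun {κ κ'} h h' => ⟨add_mem h.1 h'.1, by
    rw [extD_add h.1.smooth h'.1.smooth, h.2, h'.2, add_zero]⟩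
  zero_mem' := ⟨zero_mem _, extD_zero⟩
  smul_mem' := fun c κ h => ⟨Submodule.smul_mem _ c h.1, by rw [extD_smul, h.2, smul_zero]⟩

variable (F) in
/-- Differentials of soldered `(k-1)`-forms (none but `0` for `k = 0`). -/
def deRhamCoboundaries (ι : N → M) (ν : ∀ p : N, Submodule ℝ (Tan E (ι p))) :
    ∀ k : ℕ, Submodule ℝ (DForm E M k)
  | 0 => ⊥
  | k + 1 =>
    { carrier := {κ | ∃ η ∈ solderedForms F ι ν k, extD η = κ}
      add_mem' := by
        rintro _ _ ⟨η, hη, rfl⟩ ⟨η', hη', rfl⟩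
        exact ⟨η + η', add_mem hη hη', extD_add hη.smooth hη'.smooth⟩
      zero_mem' := ⟨0, zero_mem _, extD_zero⟩
      smul_mem' := by
        rintro c _ ⟨η, hη, rfl⟩
        exact ⟨c • η, Submodule.smul_mem _ c hη, extD_smul c η⟩ }

variable (F) in
/-- Soldered de Rham cohomology `H^k_sdeR(M, N, ν)`: the cohomology of the complex of soldered
forms with the exterior differential, i.e. cocycles modulo those cocycles that are coboundaries. -/
abbrev SolderedDeRham (ι : N → M) (ν : ∀ p : N, Submodule ℝ (Tan E (ι p))) (k : ℕ) : Type _ :=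
  deRhamCocycles F ι ν k ⧸ (deRhamCoboundaries F ι ν k).submoduleOf (deRhamCocycles F ι ν k)

variable (F) in
/-- Soldered `k`-vector fields `Q` with `∂_P Q = 0`. -/
def poissonCocycles (P : MVField E M 2) (ι : N → M) (ν : ∀ p : N, Submodule ℝ (Tan E (ι p)))
    (k : ℕ) : Submodule ℝ (MVField E M k) where
  carrier := {Q | Q ∈ solderedMVFields F ι ν k ∧ poissonD P Q = 0}
  add_mem' := fun {Q Q'} h h' => ⟨add_mem h.1 h'.1, by
    rw [poissonD_add P h.1.smooth h'.1.smooth, h.2, h'.2, add_zero]⟩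
  zero_mem' := ⟨zero_mem _, poissonD_zero P⟩
  smul_mem' := fun c Q h => ⟨Submodule.smul_mem _ c h.1, by
    rw [poissonD_smul P c h.1.smooth, h.2, smul_zero]⟩

variable (F) in
/-- Images under `∂_P` of soldered `(k-1)`-vector fields (none but `0` for `k = 0`). -/
def poissonCoboundaries (P : MVField E M 2) (ι : N → M)
    (ν : ∀ p : N, Submodule ℝ (Tan E (ι p))) : ∀ k : ℕ, Submodule ℝ (MVField E M k)
  | 0 => ⊥
  | k + 1 =>
    { carrier := {Q | ∃ R ∈ solderedMVFields F ι ν k, poissonD P R = Q}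
      add_mem' := by
        rintro _ _ ⟨R, hR, rfl⟩ ⟨R', hR', rfl⟩
        exact ⟨R + R', add_mem hR hR', poissonD_add P hR.smooth hR'.smooth⟩
      zero_mem' := ⟨0, zero_mem _, poissonD_zero P⟩
      smul_mem' := by
        rintro c _ ⟨R, hR, rfl⟩
        exact ⟨c • R, Submodule.smul_mem _ c hR, poissonD_smul P c hR.smooth⟩ }

variable (F) in
/-- Soldered Poisson cohomology `H^k_sP(M, N, ν)`: the cohomology of the complex of soldered
multivector fields with the Lichnerowicz-Poisson coboundary `∂_P = -[P, ·]`, i.e. cocycles modulo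
those cocycles that are coboundaries. -/
abbrev SolderedPoissonCohomology (P : MVField E M 2) (ι : N → M)
    (ν : ∀ p : N, Submodule ℝ (Tan E (ι p))) (k : ℕ) : Type _ :=
  poissonCocycles F P ι ν k ⧸
    (poissonCoboundaries F P ι ν k).submoduleOf (poissonCocycles F P ι ν k)

end Soldered

end SolderedPoisson

set_option linter.unusedSectionVars false

namespace SolderedPoisson

/-! ### Alternating maps -/

section Alternating

variable {V W : Type*} [NormedAddCommGroup V] [NormedSpace ℝ V]
  [NormedAddCommGroup W] [NormedSpace ℝ W] {k : ℕ}

/-! Two properties of `♯` carry the result: it is a chain map, and it preserves soldering.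

The chain property does not involve the submanifold. In a chart, `[P, ♯κ]` consists, up to sign, of
`dκ` evaluated on the vectors `♯αᵢ`, together with terms of `κ` in which one argument `♯αⱼ` is
replaced by an expression depending on a pair `αᵢ, αⱼ`. The Jacobi identity `[P, P] = 0` makes this
expression symmetric in the pair (`fderiv_sharpFlat_sub`), and alternation then kills the sum
(`sum_removeNth_update_eq_zero`). This gives `schoutenFlat_sharpFormFlat` and, on the manifold,
`poissonD_sharpForm`.

For soldering, let `X` be normal and let all `αᵢ` lie in `ann ν`. By the Leibniz rule, `L_X(♯κ)(α)`
is, up to sign, `(L_X κ)(♯α₁, …)` plus terms `κ(…, (L_X P)(αⱼ, ·), …)`. The vectors `♯αᵢ` are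
tangent to `N`. Cartan's formula leaves `i(X)dκ` from the first part, since `i(X)κ` pulls back to
zero on `N` and pullback commutes with `d`. The vector `(L_X P)(αⱼ, ·)` is normal by the Dirac
condition, so the other terms vanish: apply `X` to `{f, g}` for functions with `df, dg` in `ann ν`
along `N`, and note that `Xf` and `Xg` vanish on `N` (`IsDirac.lieDerivFlat_eq_zero`). What remains
is `lieDeriv_sharpForm_eq`, which matches the condition on `L_X(♯κ)` with the one on `i(X)dκ`. The
tangency condition on `♯κ` matches the one on `i(X)κ`, because `♯` sends covectors killing `TN` into
`ν`.

If `P` comes from a symplectic form, `♯` is invertible, and the splittings of `TM` and `T*M` along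
`N` show that it maps `ann ν` onto `TN` and `ann TN` onto `ν`. The argument can then be read
backwards, so `♯` is already an isomorphism of the soldered complexes.

The passage between pointwise conditions and conditions on vector fields or functions rests on
`exists_adapted_chart`, where `N` is a slice and `ν` is a coordinate distribution along it; cutoffs
then give global extensions. -/

theorem map_update_eq_vecCons (f : V [⋀^Fin (k + 1)]→L[ℝ] ℝ) (u : Fin (k + 1) → V)
    (i : Fin (k + 1)) (w : V) :
    f (Function.update u i w) = (-1) ^ (i : ℕ) * f (Matrix.vecCons w (i.removeNth u)) := by
  rw [← Fin.insertNth_removeNth, ContinuousAlternatingMap.map_insertNth]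
  simp

theorem map_snoc_eq_vecCons (f : V [⋀^Fin (k + 1)]→L[ℝ] ℝ) (u : Fin k → V) (w : V) :
    f (Fin.snoc (α := fun _ => V) u w) = (-1) ^ k * f (Matrix.vecCons w u) := by
  rw [← Fin.insertNth_last', ContinuousAlternatingMap.map_insertNth]
  simp

/-- An alternating map antisymmetrizes the replacement of pairs of arguments by a symmetric
expression to zero. -/
theorem sum_removeNth_update_eq_zero (f : V [⋀^Fin k]→L[ℝ] ℝ) (a : Fin (k + 1) → V)
    (B : Fin (k + 1) → Fin (k + 1) → V) (hB : ∀ p q, B p q = B q p) :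
    ∑ i : Fin (k + 1), (-1 : ℝ) ^ (i : ℕ) *
      ∑ j : Fin k, f (Function.update (i.removeNth a) j (B i (i.succAbove j))) = 0 := by
  set T : Fin (k + 1) → Fin (k + 1) → ℝ := fun p q =>
    if p = q then 0 else (-1 : ℝ) ^ (p : ℕ) * f (p.removeNth (Function.update a q (B p q))) with hT
  have anti : ∀ p q, T p q = -T q p := fun p q => by
    rcases eq_or_ne p q with rfl | h
    · simp [hT]
    -- With the same vector `B p q` placed in both slots `p` and `q`, deleting one slot or the other
    -- gives the same value up to the sign of moving the vector across.
    have key := f.neg_one_pow_smul_map_removeNth_add_eq_zero_of_eq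
      (v := Function.update (Function.update a p (B p q)) q (B p q)) (i := p) (j := q)
      (by simp [h]) h
    have h1 : p.removeNth (Function.update (Function.update a p (B p q)) q (B p q)) =
        p.removeNth (Function.update a q (B p q)) := by
      rw [Function.update_comm h, Fin.removeNth_update]
    have h2 : q.removeNth (Function.update (Function.update a p (B p q)) q (B p q)) =
        q.removeNth (Function.update a p (B q p)) := by
      rw [Fin.removeNth_update, hB p q]
    rw [h1, h2] at key
    simp only [hT, if_neg h, if_neg h.symm]
    simp only [zsmul_eq_mul, Int.cast_pow, Int.cast_neg, Int.cast_one] at key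
    linarith
  have hsum : ∑ i : Fin (k + 1), (-1 : ℝ) ^ (i : ℕ) *
      ∑ j : Fin k, f (Function.update (i.removeNth a) j (B i (i.succAbove j))) =
      ∑ p, ∑ q, T p q := by
    refine Finset.sum_congr rfl fun i _ => ?_
    rw [Fin.sum_univ_succAbove (T i) i, Finset.mul_sum]
    simp only [hT, if_true, zero_add]
    refine Finset.sum_congr rfl fun j _ => ?_
    rw [if_neg (Fin.succAbove_ne i j).symm]
    congr 2
    funext l
    rcases eq_or_ne l j with rfl | h
    · simp [Fin.removeNth]
    · simp [Fin.removeNth, h]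
  rw [hsum]
  have h : ∑ p, ∑ q, T p q = -∑ p, ∑ q, T p q := by
    conv_lhs => rw [Finset.sum_comm]
    simp only [← Finset.sum_neg_distrib]
    exact Finset.sum_congr rfl fun p _ => Finset.sum_congr rfl fun q _ => anti q p
  linarith

/-- The alternating maps are a retract of the multilinear maps. -/
theorem exists_retraction_toContinuousMultilinearMap (V : Type*) [NormedAddCommGroup V]
    [NormedSpace ℝ V] (k : ℕ) :
    ∃ r : ContinuousMultilinearMap ℝ (fun _ : Fin k => V) ℝ →L[ℝ] V [⋀^Fin k]→L[ℝ] ℝ,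
      ∀ f : V [⋀^Fin k]→L[ℝ] ℝ, r f.toContinuousMultilinearMap = f := by
  let A : ContinuousMultilinearMap ℝ (fun _ : Fin k => V) ℝ →ₗ[ℝ] V [⋀^Fin k]→L[ℝ] ℝ :=
    { toFun := fun f => ContinuousMultilinearMap.alternatization f
      map_add' := map_add _
      map_smul' := fun c f => by
        ext v
        simp only [ContinuousMultilinearMap.alternatization_apply_apply,
          smul_apply, ContinuousAlternatingMap.smul_apply,
          RingHom.id_apply, Finset.smul_sum]
        exact Finset.sum_congr rfl fun σ _ => smul_comm _ _ _ }
  have hA : ∀ f, ‖A f‖ ≤ (Nat.factorial k : ℝ) * ‖f‖ := fun f => by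
    refine ContinuousAlternatingMap.opNorm_le_bound _ (by positivity) fun v => ?_
    change ‖ContinuousMultilinearMap.alternatization f v‖ ≤ _
    rw [ContinuousMultilinearMap.alternatization_apply_apply]
    refine (norm_sum_le _ _).trans ?_
    have : ∀ σ ∈ (Finset.univ : Finset (Equiv.Perm (Fin k))),
        ‖Equiv.Perm.sign σ • f (v ∘ σ)‖ ≤ ‖f‖ * ∏ i, ‖v i‖ := fun σ _ => by
      have h1 : ‖Equiv.Perm.sign σ • f (v ∘ σ)‖ = ‖f (v ∘ σ)‖ := by
        rcases Int.units_eq_one_or (Equiv.Perm.sign σ) with h | h <;> simp [h]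
      rw [h1, ← Equiv.prod_comp σ fun i => ‖v i‖]
      exact f.le_opNorm _
    refine (Finset.sum_le_card_nsmul _ _ _ this).trans (le_of_eq ?_)
    rw [Finset.card_univ, Fintype.card_perm, Fintype.card_fin, nsmul_eq_mul]
    ring
  refine ⟨((Nat.factorial k : ℝ)⁻¹) • A.mkContinuous _ hA, fun f => ?_⟩
  ext v
  change (Nat.factorial k : ℝ)⁻¹ •
    ContinuousMultilinearMap.alternatization f.toContinuousMultilinearMap v = f v
  rw [ContinuousMultilinearMap.alternatization_apply_apply]
  have : ∀ σ : Equiv.Perm (Fin k),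
      Equiv.Perm.sign σ • f.toContinuousMultilinearMap (v ∘ σ) = f v := fun σ => by
    have h := f.toAlternatingMap.map_perm v σ
    change Equiv.Perm.sign σ • f (v ∘ σ) = f v
    have h' : f (v ∘ σ) = Equiv.Perm.sign σ • f v := h
    rw [h', smul_smul, ← sq, Int.units_sq, one_smul]
  rw [Finset.sum_congr rfl fun σ _ => this σ, Finset.sum_const, Finset.card_univ,
    Fintype.card_perm, Fintype.card_fin, nsmul_eq_mul, smul_eq_mul,
    inv_mul_cancel_left₀ (by positivity)]

/-- For multilinear maps, composition is itself multilinear in the inner maps, hence smooth. The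
retraction carries this over to alternating maps. -/
theorem contDiff_compContinuousLinearMap (V W : Type*) [NormedAddCommGroup V] [NormedSpace ℝ V]
    [NormedAddCommGroup W] [NormedSpace ℝ W] (k : ℕ) {n : WithTop ℕ∞} :
    ContDiff ℝ n (fun p : (W [⋀^Fin k]→L[ℝ] ℝ) × (V →L[ℝ] W) =>
      p.1.compContinuousLinearMap p.2) := by
  obtain ⟨r, hr⟩ := exists_retraction_toContinuousMultilinearMap V k
  have h1 : ContDiff ℝ n (fun p : (W [⋀^Fin k]→L[ℝ] ℝ) × (V →L[ℝ] W) =>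
      ContinuousMultilinearMap.compContinuousLinearMapContinuousMultilinear ℝ
        (fun _ : Fin k => V) (fun _ => W) ℝ (fun _ => p.2) p.1.toContinuousMultilinearMap) := by
    refine ContDiff.clm_apply ?_ ?_
    · exact (ContinuousMultilinearMap.contDiff _).comp (contDiff_pi.2 fun _ => contDiff_snd)
    · exact (ContinuousAlternatingMap.toContinuousMultilinearMapLI (𝕜 := ℝ) (E := W) (F := ℝ)
        (ι := Fin k)).toContinuousLinearMap.contDiff.comp contDiff_fst
  have h2 : (fun p : (W [⋀^Fin k]→L[ℝ] ℝ) × (V →L[ℝ] W) => p.1.compContinuousLinearMap p.2) =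
      r ∘ fun p => ContinuousMultilinearMap.compContinuousLinearMapContinuousMultilinear ℝ
        (fun _ : Fin k => V) (fun _ => W) ℝ (fun _ => p.2) p.1.toContinuousMultilinearMap :=
    funext fun p => (hr (p.1.compContinuousLinearMap p.2)).symm
  rw [h2]
  exact r.contDiff.comp h1

theorem ContDiffOn.altCompContinuousLinearMap {U : Type*} [NormedAddCommGroup U]
    [NormedSpace ℝ U] {n : WithTop ℕ∞} {s : Set U} {f : U → W [⋀^Fin k]→L[ℝ] ℝ}
    {g : U → V →L[ℝ] W} (hf : ContDiffOn ℝ n f s) (hg : ContDiffOn ℝ n g s) :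
    ContDiffOn ℝ n (fun y => (f y).compContinuousLinearMap (g y)) s :=
  (contDiff_compContinuousLinearMap V W k).comp_contDiffOn (hf.prodMk hg)

theorem fderiv_altComp_apply {U : Type*} [NormedAddCommGroup U]
    [NormedSpace ℝ U] {f : U → W [⋀^Fin k]→L[ℝ] ℝ} {g : U → V →L[ℝ] W} {y : U}
    (hf : DifferentiableAt ℝ f y) (hg : DifferentiableAt ℝ g y) (v : U) (α : Fin k → V) :
    fderiv ℝ (fun y => (f y).compContinuousLinearMap (g y)) y v α =
      fderiv ℝ f y v (fun i => g y (α i)) +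
        ∑ j, f y (Function.update (fun i => g y (α i)) j (fderiv ℝ g y v (α j))) := by
  rw [fderiv_continuousAlternatingMapCompContinuousLinearMap hf hg]
  simp only [add_apply, ContinuousLinearMap.comp_apply,
    ContinuousAlternatingMap.add_apply, ContinuousAlternatingMap.fderivCompContinuousLinearMap_apply]
  congr 1
  refine Finset.sum_congr rfl fun j _ => congrArg (f y) (funext fun i => ?_)
  rcases eq_or_ne i j with rfl | h
  · simp
  · simp [h]

end Alternating

end SolderedPoisson

namespace SolderedPoisson

/-! ### Calculus in a chart -/

section FlatCalculus

variable {E : Type*} [NormedAddCommGroup E] [NormedSpace ℝ E] {k : ℕ}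

/-- Lie derivative of a `k`-form along a vector field. -/
def lieFormFlat (X : E → E) (κ : E → E [⋀^Fin k]→L[ℝ] ℝ) (y : E) (u : Fin k → E) : ℝ :=
  fderiv ℝ κ y (X y) u + ∑ j, κ y (Function.update u j (fderiv ℝ X y (u j)))

/-- Cartan's formula. -/
theorem lieFormFlat_eq (X : E → E) (κ : E → E [⋀^Fin (k + 1)]→L[ℝ] ℝ) (y : E)
    (hX : DifferentiableAt ℝ X y) (hκ : DifferentiableAt ℝ κ y) (u : Fin (k + 1) → E) :
    lieFormFlat X κ y u = extDeriv κ y (Matrix.vecCons (X y) u) +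
      extDeriv (fun z => (κ z).curryLeft (X z)) y u := by
  have hc : HasFDerivAt (fun z => (κ z).curryLeft)
      ((ContinuousAlternatingMap.curryLeftLI (𝕜 := ℝ) (E := E) (F := ℝ)
        (n := k)).toContinuousLinearMap ∘L fderiv ℝ κ y) y :=
    (ContinuousAlternatingMap.curryLeftLI (𝕜 := ℝ) (E := E) (F := ℝ)
        (n := k)).toContinuousLinearMap.hasFDerivAt.comp y hκ.hasFDerivAt
  have hi := hc.clm_apply hX.hasFDerivAt
  rw [extDeriv, extDeriv, ContinuousAlternatingMap.alternatizeUncurryFin_apply,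
    ContinuousAlternatingMap.alternatizeUncurryFin_apply, Fin.sum_univ_succ, hi.fderiv, lieFormFlat]
  have h1 : ∀ i : Fin (k + 1), i.succ.removeNth (Matrix.vecCons (X y) u) =
      Matrix.vecCons (X y) (i.removeNth u) := fun i => by
    funext l
    refine Fin.cases ?_ (fun l => ?_) l
    · simp [Fin.removeNth]
    · simp [Fin.removeNth]
  have h2 : (0 : Fin (k + 2)).removeNth (Matrix.vecCons (X y) u) = u := by
    funext l
    simp [Fin.removeNth]
  simp only [h1, h2, map_update_eq_vecCons]
  simp only [Fin.val_zero, pow_zero, Matrix.cons_val_zero, one_smul, Fin.val_succ,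
    Matrix.cons_val_succ, add_apply, ContinuousLinearMap.comp_apply,
    ContinuousAlternatingMap.add_apply, ContinuousLinearMap.flip_apply, zsmul_eq_mul]
  -- Slot `0` of `dκ` has given the derivative of `κ` along `X`. In the other slots the derivatives
  -- of `κ` along `uᵢ` cancel against those in `d(i(X)κ)`, and only the derivatives of `X` survive.
  rw [add_assoc, ← Finset.sum_add_distrib]
  congr 1
  refine Finset.sum_congr rfl fun i _ => ?_
  have h3 : (((ContinuousAlternatingMap.curryLeftLI (𝕜 := ℝ) (E := E) (F := ℝ)
      (n := k)).toContinuousLinearMap (fderiv ℝ κ y (u i))) (X y)) (i.removeNth u) =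
      fderiv ℝ κ y (u i) (Matrix.vecCons (X y) (i.removeNth u)) := rfl
  have h4 : ((κ y).curryLeft (fderiv ℝ X y (u i))) (i.removeNth u) =
      κ y (Matrix.vecCons (fderiv ℝ X y (u i)) (i.removeNth u)) := rfl
  rw [h3, h4]
  push_cast
  ring

/-- Cartan's formula in degree zero, where the contraction term is absent. -/
theorem lieFormFlat_zero (X : E → E) (κ : E → E [⋀^Fin 0]→L[ℝ] ℝ) (y : E)
    (u : Fin 0 → E) :
    lieFormFlat X κ y u = extDeriv κ y (Matrix.vecCons (X y) u) := by
  rw [extDeriv, ContinuousAlternatingMap.alternatizeUncurryFin_apply, lieFormFlat]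
  simp

theorem bivector_swap (P : (E →L[ℝ] ℝ) [⋀^Fin 2]→L[ℝ] ℝ) (α β : E →L[ℝ] ℝ) :
    P ![α, β] = -P ![β, α] := by
  have h := P.toAlternatingMap.map_swap ![β, α] (i := 0) (j := 1) (by simp)
  have h2 : (![β, α] ∘ (Equiv.swap (0 : Fin 2) 1) : Fin 2 → (E →L[ℝ] ℝ)) = ![α, β] := by
    funext i
    fin_cases i <;> simp
  rw [h2] at h
  exact h

theorem eq_of_forall_covector {u v : E} (h : ∀ β : E →L[ℝ] ℝ, β u = β v) : u = v :=
  sub_eq_zero.1 (SeparatingDual.eq_zero_of_forall_dual_eq_zero (R := ℝ) fun β => by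
    rw [map_sub, h, sub_self])

variable [FiniteDimensional ℝ E]

/-- `sharpFlat` as a continuous linear map. -/
def sharpFlatCLM (E : Type*) [NormedAddCommGroup E] [NormedSpace ℝ E] [FiniteDimensional ℝ E] :
    ((E →L[ℝ] ℝ) [⋀^Fin 2]→L[ℝ] ℝ) →L[ℝ] ((E →L[ℝ] ℝ) →L[ℝ] E) :=
  (ContinuousLinearMap.compL ℝ (E →L[ℝ] ℝ) ((E →L[ℝ] ℝ) [⋀^Fin 1]→L[ℝ] ℝ) E
    ((bidualEquiv E).symm.toContinuousLinearMap ∘L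
      (ContinuousAlternatingMap.ofSubsingletonLIE (𝕜 := ℝ) (E := E →L[ℝ] ℝ) (F := ℝ)
        (0 : Fin 1)).symm.toContinuousLinearEquiv.toContinuousLinearMap)) ∘L
  (ContinuousAlternatingMap.curryLeftLI (𝕜 := ℝ) (E := E →L[ℝ] ℝ) (F := ℝ)
    (n := 1)).toContinuousLinearMap

theorem apply_sharpFlat_swap (P : (E →L[ℝ] ℝ) [⋀^Fin 2]→L[ℝ] ℝ) (α β : E →L[ℝ] ℝ) :
    β (sharpFlat P α) = -α (sharpFlat P β) := by
  rw [apply_sharpFlat, apply_sharpFlat, bivector_swap]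

/-! ### The Jacobi identity and Lie derivatives of `♯` in a chart -/

section Sharp

variable {P : E → (E →L[ℝ] ℝ) [⋀^Fin 2]→L[ℝ] ℝ} {y : E}

theorem differentiableAt_sharpFlat (hP : DifferentiableAt ℝ P y) :
    DifferentiableAt ℝ (fun z => sharpFlat (P z)) y :=
  (sharpFlatCLM E).differentiableAt.comp y hP

theorem apply_fderiv_sharpFlat (hP : DifferentiableAt ℝ P y) (v : E) (α β : E →L[ℝ] ℝ) :
    β (fderiv ℝ (fun z => sharpFlat (P z)) y v α) = fderiv ℝ P y v ![α, β] := by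
  have h : HasFDerivAt (fun z => sharpFlat (P z)) (sharpFlatCLM E ∘L fderiv ℝ P y) y :=
    (sharpFlatCLM E).hasFDerivAt.comp y hP.hasFDerivAt
  rw [h.fderiv]
  exact apply_sharpFlat _ _ _

/-- The Jacobi identity: `[♯α, ♯β] = ♯ d(P(α, β))` for constant covectors `α` and `β`. -/
theorem fderiv_sharpFlat_sub (hP : DifferentiableAt ℝ P y) (hJ : schoutenFlat P P y = 0)
    (α β : E →L[ℝ] ℝ) :
    fderiv ℝ (fun z => sharpFlat (P z)) y (sharpFlat (P y) α) β -
      fderiv ℝ (fun z => sharpFlat (P z)) y (sharpFlat (P y) β) α =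
      sharpFlat (P y) (β ∘L (fderiv ℝ (fun z => sharpFlat (P z)) y).flip α) := by
  refine eq_of_forall_covector fun γ => ?_
  have h := congrArg (fun q => q ![α, β, γ]) hJ
  simp only [schoutenFlat_apply] at h
  rw [Fin.sum_univ_three] at h
  simp only [Fin.sum_univ_two] at h
  have e0 : (0 : Fin 3).removeNth ![α, β, γ] = ![β, γ] := by
    funext l; fin_cases l <;> rfl
  have e1 : (1 : Fin 3).removeNth ![α, β, γ] = ![α, γ] := by
    funext l; fin_cases l <;> rfl
  have e2 : (2 : Fin 3).removeNth ![α, β, γ] = ![α, β] := by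
    funext l; fin_cases l <;> rfl
  have u0 : ∀ a b c : E →L[ℝ] ℝ, Function.update ![a, b] 0 c = ![c, b] := fun a b c => by
    funext l; fin_cases l <;> rfl
  have u1 : ∀ a b c : E →L[ℝ] ℝ, Function.update ![a, b] 1 c = ![a, c] := fun a b c => by
    funext l; fin_cases l <;> rfl
  rw [e0, e1, e2] at h
  simp only [u0, u1, Matrix.cons_val_zero, Matrix.cons_val_one, Matrix.cons_val] at h
  -- Every term of `[P, P](α, β, γ)` becomes a derivative of `P` along `♯` of one argument,
  -- evaluated on the other two. Each of the three cyclic terms then occurs with total coefficient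
  -- `2`, and their sum being zero is the claim paired with `γ`.
  have key : ∀ a b c : E →L[ℝ] ℝ,
      P y ![a, b ∘L (fderiv ℝ (fun z => sharpFlat (P z)) y).flip c] =
        fderiv ℝ P y (sharpFlat (P y) a) ![c, b] := fun a b c => by
    rw [← apply_sharpFlat, ← apply_fderiv_sharpFlat hP]
    rfl
  have key2 : ∀ a b c : E →L[ℝ] ℝ,
      P y ![b ∘L (fderiv ℝ (fun z => sharpFlat (P z)) y).flip c, a] =
        -fderiv ℝ P y (sharpFlat (P y) a) ![c, b] := fun a b c => by
    rw [bivector_swap, key]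
  simp only [key, key2] at h
  rw [map_sub, apply_fderiv_sharpFlat hP, apply_fderiv_sharpFlat hP, apply_sharpFlat, key2]
  rw [bivector_swap (fderiv ℝ P y (sharpFlat (P y) α)) γ β,
    bivector_swap (fderiv ℝ P y (sharpFlat (P y) β)) γ α,
    bivector_swap (fderiv ℝ P y (sharpFlat (P y) γ)) β α] at h
  norm_num at h
  linarith

/-- Extension of `♯` to forms in a chart. -/
def sharpFormFlat (P : E → (E →L[ℝ] ℝ) [⋀^Fin 2]→L[ℝ] ℝ) (κ : E → E [⋀^Fin k]→L[ℝ] ℝ) (z : E) :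
    (E →L[ℝ] ℝ) [⋀^Fin k]→L[ℝ] ℝ :=
  (-1 : ℝ) ^ k • (κ z).compContinuousLinearMap (sharpFlat (P z))

theorem fderiv_sharpFormFlat (hP : DifferentiableAt ℝ P y) {κ : E → E [⋀^Fin k]→L[ℝ] ℝ}
    (hκ : DifferentiableAt ℝ κ y) (v : E) (α : Fin k → (E →L[ℝ] ℝ)) :
    fderiv ℝ (sharpFormFlat P κ) y v α = (-1 : ℝ) ^ k *
      (fderiv ℝ κ y v (fun i => sharpFlat (P y) (α i)) +
        ∑ j, κ y (Function.update (fun i => sharpFlat (P y) (α i)) j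
          (fderiv ℝ (fun z => sharpFlat (P z)) y v (α j)))) := by
  have h : sharpFormFlat P κ =
      (-1 : ℝ) ^ k • fun z => (κ z).compContinuousLinearMap (sharpFlat (P z)) := rfl
  rw [h, fderiv_const_smul
    (hκ.continuousAlternatingMapCompContinuousLinearMap (differentiableAt_sharpFlat hP))]
  have h2 := fderiv_altComp_apply hκ (differentiableAt_sharpFlat hP) v α
  simp only [smul_apply, ContinuousAlternatingMap.smul_apply, smul_eq_mul, h2]

theorem sharpFormFlat_update (κ : E → E [⋀^Fin k]→L[ℝ] ℝ) (α : Fin k → (E →L[ℝ] ℝ)) (j : Fin k)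
    (β : E →L[ℝ] ℝ) :
    sharpFormFlat P κ y (Function.update α j β) = (-1 : ℝ) ^ k *
      κ y (Function.update (fun i => sharpFlat (P y) (α i)) j (sharpFlat (P y) β)) := by
  simp only [sharpFormFlat, ContinuousAlternatingMap.smul_apply, smul_eq_mul,
    ContinuousAlternatingMap.compContinuousLinearMap_apply]
  congr 2
  funext i
  rcases eq_or_ne i j with rfl | h
  · simp
  · simp [h]

/-- `♯` intertwines the exterior derivative with the bracket `[P, ·]`, up to sign. -/
theorem schoutenFlat_sharpFormFlat (hP : DifferentiableAt ℝ P y) (hJ : schoutenFlat P P y = 0)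
    {κ : E → E [⋀^Fin k]→L[ℝ] ℝ} (hκ : DifferentiableAt ℝ κ y) :
    schoutenFlat P (sharpFormFlat P κ) y =
      (-1 : ℝ) ^ k • (extDeriv κ y).compContinuousLinearMap (sharpFlat (P y)) := by
  ext α
  set S := sharpFlat (P y) with hS
  set dS := fderiv ℝ (fun z => sharpFlat (P z)) y with hdS
  -- By the Jacobi identity the inserted vector equals half of `dS (S αₚ) α_q + dS (S α_q) αₚ`,
  -- which is symmetric.
  have hz := sum_removeNth_update_eq_zero (κ y) (fun i => S (α i))
    (fun p q => dS (S (α p)) (α q) - (1 / 2 : ℝ) • S (α q ∘L dS.flip (α p))) (fun p q => by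
      have h1 := fderiv_sharpFlat_sub hP hJ (α p) (α q)
      have h2 := fderiv_sharpFlat_sub hP hJ (α q) (α p)
      rw [← hS, ← hdS] at h1 h2
      rw [← h1, ← h2]
      module)
  rw [schoutenFlat_apply]
  simp only [ContinuousAlternatingMap.smul_apply, extDeriv,
    ContinuousAlternatingMap.compContinuousLinearMap_apply,
    ContinuousAlternatingMap.alternatizeUncurryFin_apply, zsmul_eq_mul, smul_eq_mul]
  rw [Finset.mul_sum]
  have hz' := congrArg (fun t => (-1 : ℝ) ^ k * t) hz
  simp only [mul_zero] at hz'
  rw [Finset.mul_sum] at hz'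
  rw [← sub_eq_zero, ← Finset.sum_sub_distrib, ← hz']
  refine Finset.sum_congr rfl fun i _ => ?_
  rw [fderiv_sharpFormFlat hP hκ]
  simp only [sharpFormFlat_update]
  rw [← hS, ← hdS]
  have e : ∀ j : Fin k, (κ y) (Function.update (i.removeNth fun i => S (α i)) j
      (dS (S (α i)) (α (i.succAbove j)) -
        (1 / 2 : ℝ) • S (α (i.succAbove j) ∘L dS.flip (α i)))) =
      κ y (Function.update (fun l => S (i.removeNth α l)) j
          (dS (S (α i)) (i.removeNth α j))) - 1 / 2 *
      κ y (Function.update (fun l => S (i.removeNth α l)) j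
        (S (i.removeNth α j ∘L dS.flip (α i)))) := fun j => by
    rw [ContinuousAlternatingMap.map_update_sub, ContinuousAlternatingMap.map_update_smul]
    rfl
  have e2 : (i.removeNth (⇑S ∘ α)) = fun l => S (i.removeNth α l) := rfl
  simp only [e, e2, Finset.sum_sub_distrib, ← Finset.mul_sum, Function.comp_apply]
  push_cast
  ring

/-- The vector `(L_X P)(α, ·)`. -/
def lieSharpFlat (X : E → E) (P : E → (E →L[ℝ] ℝ) [⋀^Fin 2]→L[ℝ] ℝ) (y : E) (α : E →L[ℝ] ℝ) : E :=
  fderiv ℝ (fun z => sharpFlat (P z)) y (X y) α - sharpFlat (P y) (α ∘L fderiv ℝ X y) -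
    fderiv ℝ X y (sharpFlat (P y) α)

theorem apply_lieSharpFlat (hP : DifferentiableAt ℝ P y) (X : E → E) (α β : E →L[ℝ] ℝ) :
    β (lieSharpFlat X P y α) = lieDerivFlat X P y ![α, β] := by
  rw [lieSharpFlat, map_sub, map_sub, apply_fderiv_sharpFlat hP, apply_sharpFlat, lieDerivFlat,
    ContinuousAlternatingMap.sub_apply, derivAction_apply, Fin.sum_univ_two]
  have h : β (fderiv ℝ X y (sharpFlat (P y) α)) = P y ![α, β ∘L fderiv ℝ X y] := by
    rw [← apply_sharpFlat]
    rfl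
  have u0 : Function.update ![α, β] 0 (α ∘L fderiv ℝ X y) = ![α ∘L fderiv ℝ X y, β] := by
    funext l; fin_cases l <;> rfl
  have u1 : Function.update ![α, β] 1 (β ∘L fderiv ℝ X y) = ![α, β ∘L fderiv ℝ X y] := by
    funext l; fin_cases l <;> rfl
  rw [h]
  simp only [Matrix.cons_val_zero, Matrix.cons_val_one, u0, u1]
  ring

/-- Leibniz rule for the pairing of `κ` with copies of `P`: adding and subtracting `DX(♯αⱼ)` in each
slot completes the derivative of `κ` to a Lie derivative and the rest to `(L_X P)(αⱼ, ·)`. -/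
theorem lieDerivFlat_sharpFormFlat (hP : DifferentiableAt ℝ P y)
    {κ : E → E [⋀^Fin k]→L[ℝ] ℝ} (hκ : DifferentiableAt ℝ κ y) (X : E → E)
    (α : Fin k → (E →L[ℝ] ℝ)) :
    lieDerivFlat X (sharpFormFlat P κ) y α = (-1 : ℝ) ^ k *
      (lieFormFlat X κ y (fun i => sharpFlat (P y) (α i)) +
        ∑ j, κ y (Function.update (fun i => sharpFlat (P y) (α i)) j
          (lieSharpFlat X P y (α j)))) := by
  rw [lieDerivFlat, ContinuousAlternatingMap.sub_apply, fderiv_sharpFormFlat hP hκ,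
    derivAction_apply, lieFormFlat]
  simp only [sharpFormFlat_update, lieSharpFlat, ContinuousAlternatingMap.map_update_sub,
    Finset.sum_sub_distrib, ← Finset.mul_sum]
  ring

/-- Leibniz rule for `L_X` applied to `P(df, dg)`, combined with `L_X df = d(Xf)`. -/
theorem fderiv_apply_fderiv_fderiv (hP : DifferentiableAt ℝ P y) {f g : E → ℝ}
    (hf : ContDiffAt ℝ ∞ f y) (hg : ContDiffAt ℝ ∞ g y) {X : E → E}
    (hX : DifferentiableAt ℝ X y) :
    fderiv ℝ (fun z => P z ![fderiv ℝ f z, fderiv ℝ g z]) y (X y) =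
      lieDerivFlat X P y ![fderiv ℝ f y, fderiv ℝ g y] +
        P y ![fderiv ℝ (fun z => fderiv ℝ f z (X z)) y, fderiv ℝ g y] +
        P y ![fderiv ℝ f y, fderiv ℝ (fun z => fderiv ℝ g z (X z)) y] := by
  have hdf : ∀ {f : E → ℝ}, ContDiffAt ℝ ∞ f y → DifferentiableAt ℝ (fderiv ℝ f) y := fun hf =>
    (hf.fderiv_right (m := 1) (by norm_cast)).differentiableAt (by simp)
  -- The Hessian first appears with `X` in its second argument; its symmetry moves `X` to the first.
  have hXf : ∀ {f : E → ℝ}, ContDiffAt ℝ ∞ f y →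
      fderiv ℝ (fun z => fderiv ℝ f z (X z)) y =
        fderiv ℝ f y ∘L fderiv ℝ X y + fderiv ℝ (fderiv ℝ f) y (X y) := fun {f} hf => by
    ext v
    rw [((hdf hf).hasFDerivAt.clm_apply hX.hasFDerivAt).fderiv]
    simp only [add_apply, ContinuousLinearMap.comp_apply, ContinuousLinearMap.flip_apply]
    congr 1
    exact hf.isSymmSndFDerivAt (by
      rw [minSmoothness_of_isRCLikeNormedField]
      exact WithTop.coe_le_coe.2 le_top) _ _
  have h0 : (fun z => P z ![fderiv ℝ f z, fderiv ℝ g z]) =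
      fun z => P z fun i => (![fderiv ℝ f, fderiv ℝ g] i) z := by
    funext z
    congr 1
    funext i
    fin_cases i <;> rfl
  rw [h0, fderiv_continuousAlternatingMap_apply_apply hP (fun i => by
    fin_cases i
    · exact hdf hf
    · exact hdf hg)]
  have h1 : (fun i => (![fderiv ℝ f, fderiv ℝ g] i) y) = ![fderiv ℝ f y, fderiv ℝ g y] := by
    funext i
    fin_cases i <;> rfl
  have u0 : ∀ a b c : E →L[ℝ] ℝ, Function.update ![a, b] 0 c = ![c, b] := fun a b c => by
    funext l; fin_cases l <;> rfl
  have u1 : ∀ a b c : E →L[ℝ] ℝ, Function.update ![a, b] 1 c = ![a, c] := fun a b c => by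
    funext l; fin_cases l <;> rfl
  have a0 : ∀ a b c : E →L[ℝ] ℝ, P y ![a + b, c] = P y ![a, c] + P y ![b, c] := fun a b c => by
    rw [← u0 a c (a + b), ContinuousAlternatingMap.map_update_add, u0, u0]
  have a1 : ∀ a b c : E →L[ℝ] ℝ, P y ![c, a + b] = P y ![c, a] + P y ![c, b] := fun a b c => by
    rw [← u1 c a (a + b), ContinuousAlternatingMap.map_update_add, u1, u1]
  rw [h1, hXf hf, hXf hg, lieDerivFlat, ContinuousAlternatingMap.sub_apply, derivAction_apply,
    Fin.sum_univ_two, Fin.sum_univ_two]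
  simp only [u0, u1, Matrix.cons_val_zero, Matrix.cons_val_one, a0, a1]
  ring

end Sharp

end FlatCalculus

end SolderedPoisson

namespace SolderedPoisson

/-! ### Coordinate expressions -/

section Coordinates

/-- Naturality `♯_{A_*P} = A ∘ ♯_P ∘ A^*`, which lets `♯` be computed in any chart. -/
theorem sharpFlat_compContinuousLinearMap {E E' : Type*} [NormedAddCommGroup E] [NormedSpace ℝ E]
    [FiniteDimensional ℝ E] [NormedAddCommGroup E'] [NormedSpace ℝ E'] [FiniteDimensional ℝ E']
    (P : (E →L[ℝ] ℝ) [⋀^Fin 2]→L[ℝ] ℝ)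
    (A : E →L[ℝ] E') (α : E' →L[ℝ] ℝ) :
    sharpFlat (P.compContinuousLinearMap (A.precomp ℝ)) α = A (sharpFlat P (α ∘L A)) := by
  refine eq_of_forall_covector fun β => ?_
  rw [apply_sharpFlat]
  change _ = (β ∘L A) (sharpFlat P (α ∘L A))
  rw [apply_sharpFlat, ContinuousAlternatingMap.compContinuousLinearMap_apply]
  congr 1
  funext i
  fin_cases i <;> rfl

variable {E : Type*} [NormedAddCommGroup E] [NormedSpace ℝ E]
  {M : Type*} [TopologicalSpace M] [ChartedSpace E M] {k : ℕ}

theorem inChart_extChartAt (κ : DForm E M k) {x₀ z : M} (hz : z ∈ (chartAt E x₀).source) :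
    DForm.inChart κ x₀ (extChartAt 𝓘(ℝ, E) x₀ z) =
      (κ z).compContinuousLinearMap (chartDeriv x₀ z).inverse := by
  have h : (extChartAt 𝓘(ℝ, E) x₀).symm (extChartAt 𝓘(ℝ, E) x₀ z) = z :=
    (extChartAt 𝓘(ℝ, E) x₀).left_inv (by rwa [extChartAt_source])
  rw [DForm.inChart, h]

theorem mvInChart_extChartAt (Q : MVField E M k) {x₀ z : M} (hz : z ∈ (chartAt E x₀).source) :
    MVField.inChart Q x₀ (extChartAt 𝓘(ℝ, E) x₀ z) =
      (Q z).compContinuousLinearMap ((chartDeriv x₀ z).precomp ℝ) := by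
  have h : (extChartAt 𝓘(ℝ, E) x₀).symm (extChartAt 𝓘(ℝ, E) x₀ z) = z :=
    (extChartAt 𝓘(ℝ, E) x₀).left_inv (by rwa [extChartAt_source])
  rw [MVField.inChart, h]

theorem vectorInChart_extChartAt (X : ∀ x : M, Tan E x) {x₀ z : M}
    (hz : z ∈ (chartAt E x₀).source) :
    vectorInChart X x₀ (extChartAt 𝓘(ℝ, E) x₀ z) = chartDeriv x₀ z (X z) := by
  have h : (extChartAt 𝓘(ℝ, E) x₀).symm (extChartAt 𝓘(ℝ, E) x₀ z) = z :=
    (extChartAt 𝓘(ℝ, E) x₀).left_inv (by rwa [extChartAt_source])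
  rw [vectorInChart, h]

theorem exists_eq_extChartAt {x₀ : M} {y : E} (hy : y ∈ (extChartAt 𝓘(ℝ, E) x₀).target) :
    ∃ z ∈ (chartAt E x₀).source, extChartAt 𝓘(ℝ, E) x₀ z = y := by
  refine ⟨(extChartAt 𝓘(ℝ, E) x₀).symm y, ?_, (extChartAt 𝓘(ℝ, E) x₀).right_inv hy⟩
  have := (extChartAt 𝓘(ℝ, E) x₀).map_target hy
  rwa [extChartAt_source] at this

variable [IsManifold 𝓘(ℝ, E) ∞ M]

theorem chartDeriv_isInvertible {x₀ z : M} (hz : z ∈ (chartAt E x₀).source) :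
    (chartDeriv (E := E) x₀ z).IsInvertible := by
  have : IsManifold 𝓘(ℝ, E) 1 M := IsManifold.of_le (n := ∞) (by norm_cast)
  exact isInvertible_mfderiv_extChartAt (by rwa [extChartAt_source])

theorem chartDeriv_inverse_apply {x₀ z : M} (hz : z ∈ (chartAt E x₀).source) (v : Tan E z) :
    (chartDeriv (E := E) x₀ z).inverse (chartDeriv x₀ z v) = v := by
  obtain ⟨e, he⟩ := chartDeriv_isInvertible (E := E) hz
  rw [← he, ContinuousLinearMap.inverse_equiv]
  exact e.symm_apply_apply v

theorem chartDeriv_apply_inverse {x₀ z : M} (hz : z ∈ (chartAt E x₀).source) (v : E) :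
    chartDeriv x₀ z ((chartDeriv (E := E) x₀ z).inverse v) = v := by
  obtain ⟨e, he⟩ := chartDeriv_isInvertible (E := E) hz
  rw [← he, ContinuousLinearMap.inverse_equiv]
  exact e.apply_symm_apply v

theorem apply_eq_inChart (κ : DForm E M k) {x₀ z : M} (hz : z ∈ (chartAt E x₀).source)
    (u : Fin k → Tan E z) :
    κ z u = DForm.inChart κ x₀ (extChartAt 𝓘(ℝ, E) x₀ z) fun i => chartDeriv x₀ z (u i) := by
  rw [inChart_extChartAt κ hz, ContinuousAlternatingMap.compContinuousLinearMap_apply]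
  congr 1
  funext i
  exact (chartDeriv_inverse_apply hz (u i)).symm

theorem apply_eq_mvInChart (Q : MVField E M k) {x₀ z : M} (hz : z ∈ (chartAt E x₀).source)
    (α : Fin k → Cotan E z) :
    Q z α = MVField.inChart Q x₀ (extChartAt 𝓘(ℝ, E) x₀ z)
      fun i => α i ∘L (chartDeriv x₀ z).inverse := by
  rw [mvInChart_extChartAt Q hz, ContinuousAlternatingMap.compContinuousLinearMap_apply]
  congr 1
  funext i
  ext v
  exact congrArg (α i) (chartDeriv_inverse_apply hz v).symm

variable [FiniteDimensional ℝ E]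

theorem sharpFlat_mvInChart (P : MVField E M 2) {x₀ z : M} (hz : z ∈ (chartAt E x₀).source)
    (α : E →L[ℝ] ℝ) :
    sharpFlat (MVField.inChart P x₀ (extChartAt 𝓘(ℝ, E) x₀ z)) α =
      chartDeriv x₀ z (sharp P z (α ∘L chartDeriv x₀ z)) := by
  rw [mvInChart_extChartAt P hz]
  exact sharpFlat_compContinuousLinearMap (E := E) (E' := E) (P z) (chartDeriv x₀ z) α

theorem chartDeriv_sharp (P : MVField E M 2) {x₀ z : M} (hz : z ∈ (chartAt E x₀).source)
    (α : Cotan E z) :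
    chartDeriv x₀ z (sharp P z α) =
      sharpFlat (MVField.inChart P x₀ (extChartAt 𝓘(ℝ, E) x₀ z))
        (α ∘L (chartDeriv x₀ z).inverse) := by
  rw [sharpFlat_mvInChart P hz]
  congr 2
  ext v
  exact congrArg α (chartDeriv_inverse_apply hz v).symm

theorem inChart_sharpForm (P : MVField E M 2) (κ : DForm E M k) {x₀ : M} {y : E}
    (hy : y ∈ (extChartAt 𝓘(ℝ, E) x₀).target) :
    MVField.inChart (sharpForm P κ) x₀ y =
      sharpFormFlat (MVField.inChart P x₀) (DForm.inChart κ x₀) y := by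
  obtain ⟨z, hz, rfl⟩ := exists_eq_extChartAt hy
  ext α
  rw [mvInChart_extChartAt _ hz, sharpFormFlat, inChart_extChartAt κ hz]
  simp only [sharpForm, ContinuousAlternatingMap.compContinuousLinearMap_apply,
    ContinuousAlternatingMap.smul_apply]
  congr 2
  funext i
  simp only [Function.comp_apply]
  rw [sharpFlat_mvInChart P hz, chartDeriv_inverse_apply hz]
  rfl

theorem contDiffOn_sharpFlat {P : MVField E M 2} (hP : MVField.IsSmooth P) (x₀ : M) :
    ContDiffOn ℝ ∞ (fun y => sharpFlat (MVField.inChart P x₀ y))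
      (extChartAt 𝓘(ℝ, E) x₀).target :=
  (sharpFlatCLM E).contDiff.comp_contDiffOn (hP x₀)

theorem isSmooth_sharpForm {P : MVField E M 2} (hP : MVField.IsSmooth P) {κ : DForm E M k}
    (hκ : DForm.IsSmooth κ) : MVField.IsSmooth (sharpForm P κ) := fun x₀ =>
  ((ContDiffOn.altCompContinuousLinearMap (hκ x₀) (contDiffOn_sharpFlat hP x₀)).const_smul
    ((-1 : ℝ) ^ k)).congr fun _ hy => inChart_sharpForm P κ hy

theorem inChart_sharpForm_eventuallyEq (P : MVField E M 2) (κ : DForm E M k) (x : M) :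
    MVField.inChart (sharpForm P κ) x =ᶠ[𝓝 (extChartAt 𝓘(ℝ, E) x x)]
      sharpFormFlat (MVField.inChart P x) (DForm.inChart κ x) := by
  filter_upwards [(isOpen_extChartAt_target x).mem_nhds (mem_extChartAt_target x)] with y hy
  exact inChart_sharpForm P κ hy

theorem lieDeriv_sharpForm (P : MVField E M 2) (κ : DForm E M k) (X : ∀ x : M, Tan E x) (x : M)
    (α : Fin k → Cotan E x) :
    lieDeriv X (sharpForm P κ) x α =
      lieDerivFlat (vectorInChart X x) (sharpFormFlat (MVField.inChart P x) (DForm.inChart κ x))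
        (extChartAt 𝓘(ℝ, E) x x) (fun i => α i ∘L (chartDeriv x x).inverse) := by
  have h := inChart_sharpForm_eventuallyEq P κ x
  rw [lieDeriv, lieDerivFlat, h.fderiv_eq, h.self_of_nhds]
  rfl

theorem IsPoisson.schoutenFlat_eq {P : MVField E M 2} (hP : IsPoisson P) (x : M) :
    schoutenFlat (MVField.inChart P x) (MVField.inChart P x) (extChartAt 𝓘(ℝ, E) x x) = 0 := by
  ext α
  have h := congrFun hP.schouten_self x
  have h2 := congrArg (fun q => q fun i => α i ∘L chartDeriv x x) h
  simp only [schouten, ContinuousAlternatingMap.compContinuousLinearMap_apply] at h2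
  refine Eq.trans (congrArg (schoutenFlat _ _ _) (funext fun i => ?_)) h2
  ext v
  exact congrArg (α i) (chartDeriv_apply_inverse (mem_chart_source E x) v).symm

/-- `♯` is a morphism of complexes. -/
theorem poissonD_sharpForm {P : MVField E M 2} (hP : IsPoisson P) {κ : DForm E M k}
    (hκ : DForm.IsSmooth κ) : poissonD P (sharpForm P κ) = sharpForm P (extD κ) := by
  funext x
  ext α
  have h := inChart_sharpForm_eventuallyEq P κ x
  have hx := mem_chart_source E x
  have h1 : schouten P (sharpForm P κ) x =
      ((-1 : ℝ) ^ k • (extDeriv (DForm.inChart κ x)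
        (extChartAt 𝓘(ℝ, E) x x)).compContinuousLinearMap
          (sharpFlat (MVField.inChart P x (extChartAt 𝓘(ℝ, E) x x)))).compContinuousLinearMap
        ((chartDeriv x x).inverse.precomp ℝ) := by
    rw [schouten, ← schoutenFlat_sharpFormFlat (hP.smooth.differentiableAt x)
      (hP.schoutenFlat_eq x) (hκ.differentiableAt x)]
    congr 1
    rw [schoutenFlat, h.fderiv_eq, h.self_of_nhds, schoutenFlat]
  change -(schouten P (sharpForm P κ) x α) = _
  rw [h1]
  simp only [sharpForm, extD, ContinuousAlternatingMap.smul_apply,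
    ContinuousAlternatingMap.compContinuousLinearMap_apply, smul_eq_mul, pow_succ]
  rw [mul_neg_one, neg_mul]
  congr 3
  funext i
  exact (chartDeriv_sharp P hx (α i)).symm

/-! ### Inverting `♯` -/

/-- The preimage under `♯_P` of a multivector field, for invertible `♯_P`. -/
def sharpInvForm (P : MVField E M 2) (Q : MVField E M k) : DForm E M k :=
  fun x => (-1 : ℝ) ^ k • (Q x).compContinuousLinearMap (sharp P x).inverse

theorem sharpForm_sharpInvForm {P : MVField E M 2} (hP : ∀ x, (sharp P x).IsInvertible)
    (Q : MVField E M k) : sharpForm P (sharpInvForm P Q) = Q := by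
  funext x
  ext α
  simp only [sharpForm, sharpInvForm, ContinuousAlternatingMap.smul_apply,
    ContinuousAlternatingMap.compContinuousLinearMap_apply, smul_eq_mul]
  rw [← mul_assoc, ← mul_pow, neg_one_mul, neg_neg, one_pow, one_mul]
  congr 1
  funext i
  obtain ⟨e, he⟩ := hP x
  simp only [Function.comp_apply]
  rw [← he, ContinuousLinearMap.inverse_equiv]
  exact e.symm_apply_apply (α i)

theorem sharpForm_injective {P : MVField E M 2} (hP : ∀ x, (sharp P x).IsInvertible)
    {κ κ' : DForm E M k} (h : sharpForm P κ = sharpForm P κ') : κ = κ' := by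
  funext x
  ext u
  have h1 := congrArg (fun q => q fun i => (sharp P x).inverse (u i)) (congrFun h x)
  simp only [sharpForm, ContinuousAlternatingMap.smul_apply,
    ContinuousAlternatingMap.compContinuousLinearMap_apply, smul_eq_mul] at h1
  have h2 := mul_left_cancel₀ (pow_ne_zero k (by norm_num)) h1
  convert h2 using 2 <;>
  · funext i
    obtain ⟨e, he⟩ := hP x
    simp only [Function.comp_apply]
    rw [← he, ContinuousLinearMap.inverse_equiv]
    exact (e.apply_symm_apply (u i)).symm

/-- In a chart `♯` is a smooth family of invertible linear maps, and inversion is smooth at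
invertible maps. The rest identifies the inverse of the coordinate expression with the coordinate
expression of the inverse. -/
theorem isSmooth_sharpInvForm {P : MVField E M 2} (hP : MVField.IsSmooth P)
    (hinv : ∀ x, (sharp P x).IsInvertible) {Q : MVField E M k} (hQ : MVField.IsSmooth Q) :
    DForm.IsSmooth (sharpInvForm P Q) := fun x₀ => by
  have hS : ∀ y ∈ (extChartAt 𝓘(ℝ, E) x₀).target, ∃ z ∈ (chartAt E x₀).source,
      extChartAt 𝓘(ℝ, E) x₀ z = y ∧ ∃ e : (E →L[ℝ] ℝ) ≃L[ℝ] E,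
        (e : (E →L[ℝ] ℝ) →L[ℝ] E) = sharpFlat (MVField.inChart P x₀ y) ∧
        ∀ u, e.symm u = (sharp P z).inverse ((chartDeriv x₀ z).inverse u) ∘L
          (chartDeriv x₀ z).inverse := fun y hy => by
    obtain ⟨z, hz, rfl⟩ := exists_eq_extChartAt hy
    obtain ⟨A, hA⟩ := chartDeriv_isInvertible (E := E) hz
    obtain ⟨e, he⟩ := hinv z
    refine ⟨z, hz, rfl, ContinuousLinearEquiv.equivOfInverse
      (sharpFlat (MVField.inChart P x₀ (extChartAt 𝓘(ℝ, E) x₀ z)))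
      (((chartDeriv x₀ z).inverse.precomp ℝ) ∘L (sharp P z).inverse ∘L (chartDeriv x₀ z).inverse)
      ?_ ?_, rfl, fun u => rfl⟩
    · intro α
      rw [sharpFlat_mvInChart P hz]
      ext v
      change (sharp P z).inverse ((chartDeriv x₀ z).inverse (chartDeriv x₀ z _))
        ((chartDeriv x₀ z).inverse v) = α v
      rw [chartDeriv_inverse_apply hz, ← he, ContinuousLinearMap.inverse_equiv]
      have h1 := e.symm_apply_apply (α ∘L chartDeriv x₀ z)
      refine (congrArg (fun q : Cotan E z => q ((chartDeriv x₀ z).inverse v)) h1).trans ?_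
      exact congrArg α (chartDeriv_apply_inverse hz v)
    · intro u
      rw [sharpFlat_mvInChart P hz]
      have h1 : ((((chartDeriv x₀ z).inverse.precomp ℝ) ∘L (sharp P z).inverse ∘L
          (chartDeriv x₀ z).inverse) u) ∘L chartDeriv x₀ z =
          (sharp P z).inverse ((chartDeriv x₀ z).inverse u) := by
        ext v
        change (sharp P z).inverse _ ((chartDeriv x₀ z).inverse (chartDeriv x₀ z v)) = _
        rw [chartDeriv_inverse_apply hz]
        rfl
      rw [h1, ← he, ContinuousLinearMap.inverse_equiv]
      refine (congrArg (chartDeriv x₀ z) (e.apply_symm_apply _)).trans ?_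
      exact chartDeriv_apply_inverse hz u
  have hsm : ContDiffOn ℝ ∞ (fun y => (sharpFlat (MVField.inChart P x₀ y)).inverse)
      (extChartAt 𝓘(ℝ, E) x₀).target := fun y hy => by
    obtain ⟨z, hz, -, e, he, -⟩ := hS y hy
    have h1 := contDiffAt_map_inverse (𝕜 := ℝ) (n := ∞) e
    rw [he] at h1
    exact h1.comp_contDiffWithinAt y (contDiffOn_sharpFlat hP x₀ y hy)
  refine ((ContDiffOn.altCompContinuousLinearMap (hQ x₀) hsm).const_smul
    ((-1 : ℝ) ^ k)).congr fun y hy => ?_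
  obtain ⟨z, hz, rfl, e, he, hu⟩ := hS y hy
  rw [inChart_extChartAt _ hz]
  ext u
  rw [← he, ContinuousLinearMap.inverse_equiv]
  simp only [sharpInvForm, ContinuousAlternatingMap.smul_apply,
    ContinuousAlternatingMap.compContinuousLinearMap_apply, smul_eq_mul]
  rw [apply_eq_mvInChart Q hz]
  congr 2
  funext i
  exact (hu (u i)).symm

end Coordinates

end SolderedPoisson

namespace SolderedPoisson

/-! ### Coordinates adapted to a normalized submanifold -/

section Adapted

/-- Inverse function theorem, restricted to the open set where the derivative is invertible, so that
the inverse is smooth on the whole target and not only at one point. -/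
theorem exists_local_inverse {V W : Type*} [NormedAddCommGroup V] [NormedSpace ℝ V]
    [CompleteSpace V] [NormedAddCommGroup W] [NormedSpace ℝ W] {Φ : V → W} {D : Set V}
    (hD : IsOpen D) (hΦ : ContDiffOn ℝ ∞ Φ D) {z₀ : V} (hz₀ : z₀ ∈ D)
    (hinv : (fderiv ℝ Φ z₀).IsInvertible) :
    ∃ e : OpenPartialHomeomorph V W, z₀ ∈ e.source ∧ e.source ⊆ D ∧ (∀ z, e z = Φ z) ∧
      (∀ z ∈ e.source, ∃ B : V ≃L[ℝ] W, HasFDerivAt Φ (B : V →L[ℝ] W) z) ∧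
      ContDiffOn ℝ ∞ e.symm e.target := by
  have hat : ∀ z ∈ D, ContDiffAt ℝ ∞ Φ z := fun z hz => hΦ.contDiffAt (hD.mem_nhds hz)
  obtain ⟨B₀, hB₀⟩ := hinv
  have hder : HasFDerivAt Φ (B₀ : V →L[ℝ] W) z₀ := by
    rw [hB₀]
    exact ((hat z₀ hz₀).differentiableAt (by simp)).hasFDerivAt
  set D' : Set V := D ∩ fderiv ℝ Φ ⁻¹' range ((↑) : (V ≃L[ℝ] W) → (V →L[ℝ] W)) with hD'
  have hD'o : IsOpen D' :=
    (hΦ.continuousOn_fderiv_of_isOpen hD (by simp)).isOpen_inter_preimage hD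
      ContinuousLinearEquiv.isOpen
  have hz₀' : z₀ ∈ D' := ⟨hz₀, B₀, hB₀⟩
  set e₁ := (hat z₀ hz₀).toOpenPartialHomeomorph Φ hder (by simp) with he₁
  have hBz : ∀ z ∈ (e₁.restrOpen D' hD'o).source,
      ∃ B : V ≃L[ℝ] W, HasFDerivAt Φ (B : V →L[ℝ] W) z := fun z hz => by
    rw [OpenPartialHomeomorph.restrOpen_source] at hz
    obtain ⟨B, hB⟩ := hz.2.2
    refine ⟨B, ?_⟩
    rw [hB]
    exact ((hat z hz.2.1).differentiableAt (by simp)).hasFDerivAt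
  refine ⟨e₁.restrOpen D' hD'o, ?_, ?_, fun z => rfl, hBz, ?_⟩
  · rw [OpenPartialHomeomorph.restrOpen_source]
    exact ⟨(hat z₀ hz₀).mem_toOpenPartialHomeomorph_source hder (by simp), hz₀'⟩
  · rw [OpenPartialHomeomorph.restrOpen_source]
    exact fun z hz => hz.2.1
  · intro w hw
    have hs := (e₁.restrOpen D' hD'o).map_target hw
    obtain ⟨B, hB⟩ := hBz _ hs
    refine ((e₁.restrOpen D' hD'o).contDiffAt_symm hw hB ?_).contDiffWithinAt
    rw [OpenPartialHomeomorph.restrOpen_source] at hs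
    exact hat _ hs.2.1

variable {E : Type*} [NormedAddCommGroup E] [NormedSpace ℝ E]
  {F : Type*} [NormedAddCommGroup F] [NormedSpace ℝ F]
  {M : Type*} [TopologicalSpace M] [ChartedSpace E M]
  {N : Type*} [TopologicalSpace N] [ChartedSpace F N]

/-- In the charts of an immersion the map is `u ↦ (u, 0)`; projecting to the first factor gives a
smooth local left inverse, and the chain rule finishes. -/
theorem diffAt_injective [IsManifold 𝓘(ℝ, E) ∞ M] [IsManifold 𝓘(ℝ, F) ∞ N] {ι : N → M}
    (hι : Manifold.IsSmoothEmbedding 𝓘(ℝ, F) 𝓘(ℝ, E) ∞ ι) (p : N) :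
    Function.Injective (diffAt E F ι p) := by
  have h := hι.isImmersion.isImmersionAt p
  set g : M → N := fun x => h.domChart.symm (h.equiv.symm (h.codChart x)).1 with hg
  have hw : ∀ q ∈ h.domChart.source, h.codChart (ι q) = h.equiv (h.domChart q, 0) := fun q hq => by
    have h0 : h.domChart q ∈ (h.domChart.extend 𝓘(ℝ, F)).target := by
      simpa [OpenPartialHomeomorph.extend] using h.domChart.map_source hq
    simpa [OpenPartialHomeomorph.extend, h.domChart.left_inv hq] using h.writtenInCharts h0
  have hgi : ∀ q ∈ h.domChart.source, g (ι q) = q := fun q hq => by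
    have h2 := hw q hq
    simp only [hg]
    rw [h2, ContinuousLinearEquiv.symm_apply_apply]
    exact h.domChart.left_inv hq
  have hp := h.mem_domChart_source
  have hιs : MDifferentiableAt 𝓘(ℝ, F) 𝓘(ℝ, E) ι p :=
    (hι.contMDiff p).mdifferentiableAt (by simp)
  have hgs : MDifferentiableAt 𝓘(ℝ, E) 𝓘(ℝ, F) g (ι p) := by
    have hc : ContMDiffAt 𝓘(ℝ, E) 𝓘(ℝ, E) ∞ h.codChart (ι p) :=
      contMDiffAt_of_mem_maximalAtlas h.codChart_mem_maximalAtlas h.mem_codChart_source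
    have hl : ContMDiffAt 𝓘(ℝ, E) 𝓘(ℝ, F) ∞
        (fun u : E => (h.equiv.symm u).1) (h.codChart (ι p)) :=
      (((ContinuousLinearMap.fst ℝ F h.complement) ∘L
        (h.equiv.symm : E →L[ℝ] F × h.complement)).contDiff.contMDiff) _
    have hpt : (h.equiv.symm (h.codChart (ι p))).1 ∈ h.domChart.target := by
      have h2 := hw p hp
      rw [h2, ContinuousLinearEquiv.symm_apply_apply]
      exact h.domChart.map_source hp
    have hd : ContMDiffAt 𝓘(ℝ, F) 𝓘(ℝ, F) ∞ h.domChart.symm (h.equiv.symm (h.codChart (ι p))).1 :=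
      contMDiffAt_symm_of_mem_maximalAtlas h.domChart_mem_maximalAtlas hpt
    exact (hd.comp (ι p) (hl.comp (ι p) hc)).mdifferentiableAt (by simp)
  have hcomp := mfderiv_comp p hgs hιs
  have hid : mfderiv 𝓘(ℝ, F) 𝓘(ℝ, F) (g ∘ ι) p = ContinuousLinearMap.id ℝ _ := by
    rw [← mfderiv_id]
    refine Filter.EventuallyEq.mfderiv_eq ?_
    filter_upwards [h.domChart.open_source.mem_nhds hp] with q hq
    exact hgi q hq
  rw [hid] at hcomp
  intro u v huv
  have h1 := congrArg (fun L => L u) hcomp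
  have h2 := congrArg (fun L => L v) hcomp
  have h3 : mfderiv 𝓘(ℝ, E) 𝓘(ℝ, F) g (ι p) (diffAt E F ι p u) =
    mfderiv 𝓘(ℝ, E) 𝓘(ℝ, F) g (ι p) (diffAt E F ι p v) := by rw [huv]
  exact h1.trans (h3.trans h2.symm)

/-- The derivative of the chart at `x₀` is the fibre part of the tangent bundle trivialization
there, so smooth sections along a map have smooth components. -/
theorem contMDiffOn_chartDeriv [IsManifold 𝓘(ℝ, E) ∞ M] {f : N → M} {Y : ∀ q : N, Tan E (f q)}
    {U : Set N}
    (hY : ContMDiffOn 𝓘(ℝ, F) (𝓘(ℝ, E).tangent) ∞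
      (fun q => (⟨f q, Y q⟩ : TangentBundle 𝓘(ℝ, E) M)) U) (x₀ : M) :
    ContMDiffOn 𝓘(ℝ, F) 𝓘(ℝ, E) ∞ (fun q => (chartDeriv x₀ (f q) (Y q) : E))
      (U ∩ f ⁻¹' (chartAt E x₀).source) := by
  have : IsManifold 𝓘(ℝ, E) 1 M := IsManifold.of_le (n := ∞) (by norm_cast)
  have h1 := ((trivializationAt E (TangentSpace 𝓘(ℝ, E) : M → Type _) x₀).contMDiffOn_iff
    (IM := 𝓘(ℝ, F)) (IB := 𝓘(ℝ, E)) (n := ∞)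
    (f := fun q => (⟨f q, Y q⟩ : TangentBundle 𝓘(ℝ, E) M))
    (s := U ∩ f ⁻¹' (chartAt E x₀).source) (fun q hq => by
      rw [Bundle.Trivialization.mem_source]
      simpa using hq.2)).1 (hY.mono inter_subset_left)
  refine h1.2.congr fun q hq => ?_
  rw [chartDeriv, ← TangentBundle.continuousLinearMapAt_trivializationAt hq.2]
  rw [Bundle.Trivialization.continuousLinearMapAt_apply, Bundle.Trivialization.linearMapAt_apply,
    if_pos (by simpa using hq.2)]

theorem contDiffOn_vectorInChart [IsManifold 𝓘(ℝ, E) ∞ M] {X : ∀ x : M, Tan E x}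
    (hX : IsSmoothVectorField X) (x₀ : M) :
    ContDiffOn ℝ ∞ (vectorInChart X x₀) (extChartAt 𝓘(ℝ, E) x₀).target := by
  rw [← contMDiffOn_iff_contDiffOn]
  have h1 := contMDiffOn_chartDeriv (N := M) (f := id) (U := univ) hX.contMDiffOn x₀
  refine h1.comp (contMDiffOn_extChartAt_symm x₀) fun y hy => ?_
  have := (extChartAt 𝓘(ℝ, E) x₀).map_target hy
  rw [extChartAt_source] at this
  exact ⟨mem_univ _, this⟩

theorem IsSmoothVectorField.differentiableAt [IsManifold 𝓘(ℝ, E) ∞ M] {X : ∀ x : M, Tan E x}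
    (hX : IsSmoothVectorField X) (x : M) :
    DifferentiableAt ℝ (vectorInChart X x) (extChartAt 𝓘(ℝ, E) x x) :=
  ((contDiffOn_vectorInChart hX x).contDiffAt ((isOpen_extChartAt_target x).mem_nhds
    (mem_extChartAt_target x))).differentiableAt (by simp)

end Adapted

end SolderedPoisson

namespace SolderedPoisson

/-! ### The submanifold and its normal bundle in charts -/

section Adapted

variable {E : Type*} [NormedAddCommGroup E] [NormedSpace ℝ E]
  {F : Type*} [NormedAddCommGroup F] [NormedSpace ℝ F]
  {M : Type*} [TopologicalSpace M] [ChartedSpace E M]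
  {N : Type*} [TopologicalSpace N] [ChartedSpace F N]

/-- Coordinate expression of a map in preferred charts. -/
def mapInChart (ι : N → M) (p : N) (x₀ : M) (s : F) : E :=
  extChartAt 𝓘(ℝ, E) x₀ (ι ((extChartAt 𝓘(ℝ, F) p).symm s))

/-- The points of the target of the chart at `p` which `f` sends to `V`. -/
def chartPreimage (f : N → M) (p : N) (V : Set M) : Set F :=
  (extChartAt 𝓘(ℝ, F) p).target ∩ (extChartAt 𝓘(ℝ, F) p).symm ⁻¹' (f ⁻¹' V)

theorem isOpen_chartPreimage {f : N → M} (hf : Continuous f) (p : N) {V : Set M} (hV : IsOpen V) :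
    IsOpen (chartPreimage f p V : Set F) :=
  (continuousOn_extChartAt_symm p).isOpen_inter_preimage (isOpen_extChartAt_target p)
    (hV.preimage hf)

theorem mem_chartPreimage {f : N → M} {p q : N} {V : Set M} (hq : q ∈ (chartAt F p).source)
    (hfq : f q ∈ V) : extChartAt 𝓘(ℝ, F) p q ∈ (chartPreimage f p V : Set F) := by
  have hq' : q ∈ (extChartAt 𝓘(ℝ, F) p).source := by rwa [extChartAt_source]
  refine ⟨(extChartAt 𝓘(ℝ, F) p).map_source hq', ?_⟩
  rw [mem_preimage, (extChartAt 𝓘(ℝ, F) p).left_inv hq']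
  exact hfq

theorem extChartAt_symm_left {p q : N} (hq : q ∈ (chartAt F p).source) :
    (extChartAt 𝓘(ℝ, F) p).symm (extChartAt 𝓘(ℝ, F) p q) = q :=
  (extChartAt 𝓘(ℝ, F) p).left_inv (by rwa [extChartAt_source])

variable [IsManifold 𝓘(ℝ, E) ∞ M] [IsManifold 𝓘(ℝ, F) ∞ N] {ι : N → M}

theorem contDiffOn_mapInChart (hι : ContMDiff 𝓘(ℝ, F) 𝓘(ℝ, E) ∞ ι) (p : N) (x₀ : M) :
    ContDiffOn ℝ ∞ (mapInChart ι p x₀ : F → E) (chartPreimage ι p (chartAt E x₀).source) := by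
  rw [← contMDiffOn_iff_contDiffOn]
  exact (contMDiffOn_extChartAt (x := x₀)).comp (hι.comp_contMDiffOn
    ((contMDiffOn_extChartAt_symm p).mono inter_subset_left)) fun s hs => hs.2

theorem contDiffAt_mapInChart (hι : ContMDiff 𝓘(ℝ, F) 𝓘(ℝ, E) ∞ ι) {p q : N} {x₀ : M}
    (hq : q ∈ (chartAt F p).source) (hιq : ι q ∈ (chartAt E x₀).source) :
    ContDiffAt ℝ ∞ (mapInChart ι p x₀ : F → E) (extChartAt 𝓘(ℝ, F) p q) :=
  (contDiffOn_mapInChart hι p x₀).contDiffAt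
    ((isOpen_chartPreimage hι.continuous p (chartAt E x₀).open_source).mem_nhds
      (mem_chartPreimage hq hιq))

theorem fderiv_mapInChart (hι : ContMDiff 𝓘(ℝ, F) 𝓘(ℝ, E) ∞ ι) {p q : N} {x₀ : M}
    (hq : q ∈ (chartAt F p).source) (hιq : ι q ∈ (chartAt E x₀).source)
    (v : TangentSpace 𝓘(ℝ, F) q) :
    fderiv ℝ (mapInChart ι p x₀ : F → E) (extChartAt 𝓘(ℝ, F) p q) (chartDeriv p q v) =
      chartDeriv x₀ (ι q) (diffAt E F ι q v) := by
  have : IsManifold 𝓘(ℝ, E) 1 M := IsManifold.of_le (n := ∞) (by norm_cast)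
  have : IsManifold 𝓘(ℝ, F) 1 N := IsManifold.of_le (n := ∞) (by norm_cast)
  have hj : MDifferentiableAt 𝓘(ℝ, F) 𝓘(ℝ, E) (mapInChart ι p x₀ : F → E)
      (extChartAt 𝓘(ℝ, F) p q) :=
    ((contDiffAt_mapInChart hι hq hιq).differentiableAt (by simp)).mdifferentiableAt
  have hψ : MDifferentiableAt 𝓘(ℝ, F) 𝓘(ℝ, F) (extChartAt 𝓘(ℝ, F) p) q :=
    mdifferentiableAt_extChartAt hq
  have hφ : MDifferentiableAt 𝓘(ℝ, E) 𝓘(ℝ, E) (extChartAt 𝓘(ℝ, E) x₀) (ι q) :=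
    mdifferentiableAt_extChartAt hιq
  have hιd : MDifferentiableAt 𝓘(ℝ, F) 𝓘(ℝ, E) ι q := (hι q).mdifferentiableAt (by simp)
  have h1 := mfderiv_comp q hj hψ
  have h2 := mfderiv_comp q hφ hιd
  have h3 : (mapInChart ι p x₀ : F → E) ∘ extChartAt 𝓘(ℝ, F) p =ᶠ[𝓝 q]
      extChartAt 𝓘(ℝ, E) x₀ ∘ ι := by
    filter_upwards [(chartAt F p).open_source.mem_nhds hq] with q' hq'
    simp only [Function.comp_apply, mapInChart, extChartAt_symm_left hq']
  rw [h3.mfderiv_eq, h2, mfderiv_eq_fderiv] at h1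
  exact (congrArg (fun L => L v) h1).symm

theorem contDiffOn_sectionInChart {Y : ∀ q : N, Tan E (ι q)} {U : Set N}
    (hY : ContMDiffOn 𝓘(ℝ, F) (𝓘(ℝ, E).tangent) ∞
      (fun q => (⟨ι q, Y q⟩ : TangentBundle 𝓘(ℝ, E) M)) U) (p : N) (x₀ : M) :
    ContDiffOn ℝ ∞ (fun s : F => (chartDeriv x₀ (ι ((extChartAt 𝓘(ℝ, F) p).symm s))
        (Y ((extChartAt 𝓘(ℝ, F) p).symm s)) : E))
      (chartPreimage ι p (chartAt E x₀).source ∩ chartPreimage id p U) := by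
  rw [← contMDiffOn_iff_contDiffOn]
  exact (contMDiffOn_chartDeriv hY x₀).comp
    ((contMDiffOn_extChartAt_symm p).mono fun s hs => hs.1.1) fun s hs => ⟨hs.2.2, hs.1.2⟩

variable [FiniteDimensional ℝ E] [FiniteDimensional ℝ F]

/-- Around a point of `N` there are coordinates `T = (s, c)` of `M` in which `N` is given by
`c = 0`, and `ν` is the kernel of `ds` along `N`. -/
theorem exists_adapted_chart (hι : Manifold.IsSmoothEmbedding 𝓘(ℝ, F) 𝓘(ℝ, E) ∞ ι)
    {ν : ∀ p : N, Submodule ℝ (Tan E (ι p))} (hν : IsNormalBundle F ι ν) (p : N) :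
    ∃ (r : ℕ) (T : OpenPartialHomeomorph M (F × (Fin r → ℝ))), ι p ∈ T.source ∧
      ContMDiffOn 𝓘(ℝ, E) 𝓘(ℝ, F × (Fin r → ℝ)) ∞ T T.source ∧
      (∀ x ∈ T.source, (mfderiv 𝓘(ℝ, E) 𝓘(ℝ, F × (Fin r → ℝ)) T x).IsInvertible) ∧
      ∀ q, ι q ∈ T.source → (T (ι q)).2 = 0 ∧ ∀ v : Tan E (ι q), v ∈ ν q ↔
        (show F × (Fin r → ℝ) from mfderiv 𝓘(ℝ, E) 𝓘(ℝ, F × (Fin r → ℝ)) T (ι q) v).1 = 0 := by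
  have : IsManifold 𝓘(ℝ, E) 1 M := IsManifold.of_le (n := ∞) (by norm_cast)
  have hιs := hι.contMDiff
  obtain ⟨U, hU, hpU, r, Y, hY, hYν⟩ := hν.smooth p
  set x₀ := ι p with hx₀
  set ψ := extChartAt 𝓘(ℝ, F) p with hψ
  set Yc : Fin r → F → E := fun a s => chartDeriv x₀ (ι (ψ.symm s)) (Y a (ψ.symm s)) with hYc
  set j : F → E := mapInChart ι p x₀ with hj
  set D₁ : Set F := chartPreimage ι p (chartAt E x₀).source ∩ chartPreimage id p U with hD₁
  have hD₁o : IsOpen D₁ := (isOpen_chartPreimage hιs.continuous p (chartAt E x₀).open_source).inter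
    (isOpen_chartPreimage continuous_id p hU)
  have hYcs : ∀ a, ContDiffOn ℝ ∞ (Yc a) D₁ := fun a => contDiffOn_sectionInChart (hY a) p x₀
  have hjs : ContDiffOn ℝ ∞ j D₁ := (contDiffOn_mapInChart hιs p x₀).mono inter_subset_left
  have hmem : ∀ q ∈ (chartAt F p).source, ι q ∈ (chartAt E x₀).source → q ∈ U → ψ q ∈ D₁ :=
    fun q hq hιq hqU => ⟨mem_chartPreimage hq hιq, mem_chartPreimage hq hqU⟩
  have hYcq : ∀ q ∈ (chartAt F p).source, ∀ a, Yc a (ψ q) = chartDeriv x₀ (ι q) (Y a q) :=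
    fun q hq a => by
      simp only [hYc]
      rw [extChartAt_symm_left hq]
  -- Tubular parametrization: `s` runs along `N` and `c` collects coefficients in the local frame
  -- `Y` of `ν`. The adapted chart is its local inverse.
  set Φ : F × (Fin r → ℝ) → E := fun z => j z.1 + ∑ a, z.2 a • Yc a z.1 with hΦ
  have hΦs : ContDiffOn ℝ ∞ Φ (D₁ ×ˢ univ) := by
    refine (hjs.comp contDiffOn_fst fun z hz => hz.1).add (ContDiffOn.sum fun a _ => ?_)
    refine ContDiffOn.smul ?_ ((hYcs a).comp contDiffOn_fst fun z hz => hz.1)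
    exact ((contDiff_apply ℝ ℝ a).comp contDiff_snd).contDiffOn
  have hΦd : ∀ s ∈ D₁, HasFDerivAt Φ (fderiv ℝ j s ∘L ContinuousLinearMap.fst ℝ F (Fin r → ℝ) +
      ∑ a, ((ContinuousLinearMap.proj a) ∘L ContinuousLinearMap.snd ℝ F (Fin r → ℝ)).smulRight
        (Yc a s)) (s, 0) := fun s hs => by
    have h1 : HasFDerivAt (fun z : F × (Fin r → ℝ) => j z.1)
        (fderiv ℝ j s ∘L ContinuousLinearMap.fst ℝ F (Fin r → ℝ)) (s, 0) :=
      HasFDerivAt.comp (s, (0 : Fin r → ℝ)) (f := Prod.fst) (g := j)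
        (((hjs.contDiffAt (hD₁o.mem_nhds hs)).differentiableAt (by simp)).hasFDerivAt)
        hasFDerivAt_fst
    refine h1.add (HasFDerivAt.fun_sum fun a _ => ?_)
    have h2 : HasFDerivAt (fun z : F × (Fin r → ℝ) => Yc a z.1)
        (fderiv ℝ (Yc a) s ∘L ContinuousLinearMap.fst ℝ F (Fin r → ℝ)) (s, 0) :=
      HasFDerivAt.comp (s, (0 : Fin r → ℝ)) (f := Prod.fst) (g := Yc a)
        ((((hYcs a).contDiffAt (hD₁o.mem_nhds hs)).differentiableAt (by simp)).hasFDerivAt)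
        hasFDerivAt_fst
    have h3 : HasFDerivAt (fun z : F × (Fin r → ℝ) => z.2 a)
        ((ContinuousLinearMap.proj a) ∘L ContinuousLinearMap.snd ℝ F (Fin r → ℝ)) (s, 0) :=
      ((ContinuousLinearMap.proj (R := ℝ) (φ := fun _ : Fin r => ℝ) a) ∘L
        ContinuousLinearMap.snd ℝ F (Fin r → ℝ)).hasFDerivAt
    have h4 := h3.smul h2
    -- On the slice `c = 0` the derivatives of the frame are multiplied by zero, so only the frame
    -- itself enters `DΦ`.
    have h5 : (s, (0 : Fin r → ℝ)).2 a = 0 := rfl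
    rw [h5, zero_smul, zero_add] at h4
    exact h4
  have hΦapp : ∀ s ∈ D₁, ∀ (v : F) (c : Fin r → ℝ),
      fderiv ℝ Φ (s, 0) (v, c) = fderiv ℝ j s v + ∑ a, c a • Yc a s := fun s hs v c => by
    rw [(hΦd s hs).fderiv]
    simp
  have hp : p ∈ (chartAt F p).source := mem_chart_source F p
  have hx : ι p ∈ (chartAt E x₀).source := mem_chart_source E x₀
  have hpD : ψ p ∈ D₁ := hmem p hp hx hpU
  -- Injectivity uses `TN ∩ ν = 0`, independence of the frame and injectivity of `dι`; surjectivity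
  -- below uses `TN + ν = TM`.
  have hinj : Function.Injective (fderiv ℝ Φ (ψ p, 0)) := by
    rw [injective_iff_map_eq_zero]
    rintro ⟨v, c⟩ hvc
    rw [hΦapp _ hpD] at hvc
    simp only [hYcq p hp] at hvc
    have hv : v = chartDeriv (E := F) p p ((chartDeriv p p).inverse v) :=
      (chartDeriv_apply_inverse hp v).symm
    rw [hv, fderiv_mapInChart hιs hp hx] at hvc
    set w := (chartDeriv (E := F) p p).inverse v with hw
    have h1 : chartDeriv x₀ (ι p) (diffAt E F ι p w + ∑ a, c a • Y a p) = 0 := by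
      rw [map_add, map_sum]
      simpa only [map_smul] using hvc
    have h2 : diffAt E F ι p w + ∑ a, c a • Y a p = 0 := by
      rw [← chartDeriv_inverse_apply hx (diffAt E F ι p w + ∑ a, c a • Y a p), h1, map_zero]
    have h3 : ∑ a, c a • Y a p ∈ ν p := by
      rw [← (hYν p hpU).2]
      exact Submodule.sum_mem _ fun a _ =>
        Submodule.smul_mem _ _ (Submodule.subset_span (mem_range_self a))
    have h4 : ∑ a, c a • Y a p ∈ tangentOf E F ι p := by
      rw [← neg_eq_of_add_eq_zero_right h2]
      exact neg_mem (LinearMap.mem_range_self _ w)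
    have h5 : ∑ a, c a • Y a p = 0 := by
      have := (hν.isCompl p).disjoint
      rw [Submodule.disjoint_def] at this
      exact this _ h4 h3
    rw [h5, add_zero] at h2
    have hw0 : w = 0 := diffAt_injective hι p (h2.trans (map_zero _).symm)
    have hc0 : c = 0 := funext fun a =>
      Fintype.linearIndependent_iff.1 (hYν p hpU).1 c h5 a
    rw [hv, hw0, hc0]
    simp
  have hsurj : Function.Surjective (fderiv ℝ Φ (ψ p, 0)) := fun u => by
    have h1 : (chartDeriv x₀ (ι p)).inverse u ∈ tangentOf E F ι p ⊔ ν p := by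
      rw [(hν.isCompl p).sup_eq_top]
      exact Submodule.mem_top
    obtain ⟨t, ⟨w, rfl⟩, n, hn, htn⟩ := Submodule.mem_sup.1 h1
    rw [← (hYν p hpU).2, Submodule.mem_span_range_iff_exists_fun] at hn
    obtain ⟨c, rfl⟩ := hn
    refine ⟨(chartDeriv p p w, c), ?_⟩
    rw [hΦapp _ hpD]
    simp only [hYcq p hp]
    rw [fderiv_mapInChart hιs hp hx, ← chartDeriv_apply_inverse hx u, ← htn, map_add, map_sum]
    simp only [map_smul]
    rfl
  have hinv : (fderiv ℝ Φ (ψ p, 0)).IsInvertible :=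
    ⟨(LinearEquiv.ofBijective (fderiv ℝ Φ (ψ p, 0)).toLinearMap
      ⟨hinj, hsurj⟩).toContinuousLinearEquiv, by ext <;> rfl⟩
  obtain ⟨e, hpe, heD, heΦ, heB, hes⟩ := exists_local_inverse (hD₁o.prod isOpen_univ) hΦs
    (z₀ := (ψ p, 0)) ⟨hpD, mem_univ _⟩ hinv
  -- `G` is the part of `N` that the parametrization sees as the slice. Because `ι` is an embedding,
  -- `G` is the trace of an open set `O` of `M`, and restricting to `O` keeps other sheets of `N`
  -- out of the chart.
  set G : Set N := (chartAt F p).source ∩ ψ ⁻¹' {s | (s, (0 : Fin r → ℝ)) ∈ e.source} with hG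
  have hGo : IsOpen G := by
    have h1 : IsOpen {s : F | (s, (0 : Fin r → ℝ)) ∈ e.source} :=
      e.open_source.preimage (by fun_prop)
    have h2 := (continuousOn_extChartAt (I := 𝓘(ℝ, F)) p).isOpen_inter_preimage
      (isOpen_extChartAt_source p) h1
    rwa [extChartAt_source] at h2
  obtain ⟨O, hO, hOG⟩ := hι.isEmbedding.isInducing.isOpen_iff.1 hGo
  set T := ((chartAt E x₀).trans e.symm).restrOpen O hO with hT
  have hTs : ∀ x ∈ T.source, x ∈ (chartAt E x₀).source ∧ extChartAt 𝓘(ℝ, E) x₀ x ∈ e.target ∧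
      x ∈ O := fun x hx => by
    rw [OpenPartialHomeomorph.restrOpen_source, OpenPartialHomeomorph.trans_source] at hx
    exact ⟨hx.1.1, hx.1.2, hx.2⟩
  have hTd : ∀ x ∈ T.source, ∃ B : (F × (Fin r → ℝ)) ≃L[ℝ] E,
      HasFDerivAt Φ (B : (F × (Fin r → ℝ)) →L[ℝ] E) (T x) ∧
      mfderiv 𝓘(ℝ, E) 𝓘(ℝ, F × (Fin r → ℝ)) T x =
        (B.symm : E →L[ℝ] F × (Fin r → ℝ)) ∘L chartDeriv x₀ x := fun x hx => by
    obtain ⟨hx1, hx2, -⟩ := hTs x hx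
    obtain ⟨B, hB⟩ := heB _ (e.map_target hx2)
    refine ⟨B, hB, ?_⟩
    have h1 : HasFDerivAt e.symm (B.symm : E →L[ℝ] F × (Fin r → ℝ)) (extChartAt 𝓘(ℝ, E) x₀ x) :=
      e.hasFDerivAt_symm hx2 (hB.congr_of_eventuallyEq (Filter.Eventually.of_forall heΦ))
    have h2 : MDifferentiableAt 𝓘(ℝ, E) 𝓘(ℝ, E) (extChartAt 𝓘(ℝ, E) x₀) x :=
      mdifferentiableAt_extChartAt hx1
    exact (h1.hasMFDerivAt.comp x h2.hasMFDerivAt).mfderiv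
  refine ⟨r, T, ?_, ?_, ?_, ?_⟩
  · rw [OpenPartialHomeomorph.restrOpen_source, OpenPartialHomeomorph.trans_source]
    refine ⟨⟨hx, ?_⟩, ?_⟩
    · have h1 : e (ψ p, 0) = extChartAt 𝓘(ℝ, E) x₀ (ι p) := by
        rw [heΦ]
        simp only [hΦ, hj, mapInChart, Pi.zero_apply, zero_smul, Finset.sum_const_zero, add_zero]
        rw [← hψ, extChartAt_symm_left hp]
      have h2 := e.map_source hpe
      rw [h1] at h2
      exact h2
    · have h1 : p ∈ ι ⁻¹' O := by
        rw [hOG]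
        exact ⟨hp, hpe⟩
      exact h1
  · intro x hx
    obtain ⟨hx1, hx2, -⟩ := hTs x hx
    have h1 : ContMDiffAt 𝓘(ℝ, E) 𝓘(ℝ, F × (Fin r → ℝ)) ∞ e.symm (extChartAt 𝓘(ℝ, E) x₀ x) :=
      (hes.contDiffAt (e.open_target.mem_nhds hx2)).contMDiffAt
    exact (h1.comp x (contMDiffAt_extChartAt' hx1)).contMDiffWithinAt
  · intro x hx
    obtain ⟨B, -, hB⟩ := hTd x hx
    rw [hB]
    obtain ⟨A, hA⟩ := chartDeriv_isInvertible (E := E) (hTs x hx).1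
    rw [← hA]
    exact ⟨A.trans B.symm, rfl⟩
  · intro q hq
    obtain ⟨hq1, hq2, hqO⟩ := hTs _ hq
    have hqG : q ∈ G := by
      rw [← hOG]
      exact hqO
    have hTq : T (ι q) = (ψ q, 0) := by
      have h1 : e (ψ q, 0) = extChartAt 𝓘(ℝ, E) x₀ (ι q) := by
        rw [heΦ]
        simp only [hΦ, hj, mapInChart, Pi.zero_apply, zero_smul, Finset.sum_const_zero, add_zero]
        rw [← hψ, extChartAt_symm_left hqG.1]
      change e.symm (extChartAt 𝓘(ℝ, E) x₀ (ι q)) = _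
      rw [← h1, e.left_inv hqG.2]
    have hqD : ψ q ∈ D₁ := (heD hqG.2).1
    have hqU : q ∈ U := by
      have h1 := hqD.2.2
      rwa [mem_preimage, ← hψ, extChartAt_symm_left hqG.1] at h1
    refine ⟨by rw [hTq], fun v => ?_⟩
    obtain ⟨B, hB, hBT⟩ := hTd _ hq
    rw [hTq] at hB
    have hBc : ∀ (u : F) (c : Fin r → ℝ), B (u, c) = fderiv ℝ j (ψ q) u + ∑ a, c a • Yc a (ψ q) :=
      fun u c => by
        rw [← hΦapp _ hqD, hB.fderiv]
        rfl
    -- Along `N` the coordinate directions of `c` are exactly the frame vectors `Y a q`; hence `ν`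
    -- is the kernel of `ds` at every such `q`.
    have hB0 : ∀ c : Fin r → ℝ, B (0, c) = chartDeriv x₀ (ι q) (∑ a, c a • Y a q) := fun c => by
      rw [hBc, map_zero, zero_add, map_sum]
      simp only [hYcq q hqG.1, map_smul]
    rw [hBT]
    change v ∈ ν q ↔ (B.symm (chartDeriv x₀ (ι q) v)).1 = 0
    rw [← (hYν q hqU).2, Submodule.mem_span_range_iff_exists_fun]
    constructor
    · rintro ⟨c, rfl⟩
      rw [← hB0, B.symm_apply_apply]
    · intro h
      refine ⟨(B.symm (chartDeriv x₀ (ι q) v)).2, ?_⟩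
      have h1 : B.symm (chartDeriv x₀ (ι q) v) = (0, (B.symm (chartDeriv x₀ (ι q) v)).2) :=
        Prod.ext h rfl
      have h2 := hB0 (B.symm (chartDeriv x₀ (ι q) v)).2
      rw [← h1, B.apply_symm_apply] at h2
      refine (chartDeriv_inverse_apply hq1 _).symm.trans ?_
      rw [← h2]
      exact chartDeriv_inverse_apply hq1 v

end Adapted

end SolderedPoisson

namespace SolderedPoisson

/-! ### Global extensions by cutoff functions -/

section Extension

/-- A compact subset of the chart is closed in the Hausdorff space `M`. This makes extension by zero
smooth at points outside the chart. -/
theorem eventually_notMem_of_notMem_source {M V : Type*} [TopologicalSpace M] [T2Space M]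
    [TopologicalSpace V] (T : OpenPartialHomeomorph M V) {K : Set V} (hK : IsCompact K)
    (hKT : K ⊆ T.target) {x : M} (hx : x ∉ T.source) :
    ∀ᶠ y in 𝓝 x, y ∈ T.source → T y ∉ K := by
  have hc : IsClosed (T.symm '' K) :=
    (hK.image_of_continuousOn (T.continuousOn_symm.mono hKT)).isClosed
  have hxK : x ∉ T.symm '' K := by
    rintro ⟨z, hz, rfl⟩
    exact hx (T.map_target (hKT hz))
  filter_upwards [hc.isOpen_compl.mem_nhds hxK] with y hy hys hyK
  exact hy ⟨T y, hyK, T.left_inv hys⟩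

/-- Cutoff functions for a product decomposition. -/
theorem exists_product_bump {A B : Type*} [NormedAddCommGroup A] [NormedSpace ℝ A]
    [FiniteDimensional ℝ A] [NormedAddCommGroup B] [NormedSpace ℝ B] [FiniteDimensional ℝ B]
    {O : Set (A × B)} (hO : IsOpen O) {a : A} {b : B} (hab : (a, b) ∈ O) :
    ∃ (K : Set (A × B)) (χ : A → ℝ) (η : B → ℝ), IsCompact K ∧ K ⊆ O ∧ ContDiff ℝ ∞ χ ∧
      ContDiff ℝ ∞ η ∧ χ =ᶠ[𝓝 a] 1 ∧ η =ᶠ[𝓝 b] 1 ∧ ∀ z ∉ K, χ z.1 * η z.2 = 0 := by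
  obtain ⟨ε, hε, hball⟩ := Metric.isOpen_iff.1 hO _ hab
  let f : ContDiffBump a := ⟨ε / 4, ε / 2, by positivity, by linarith⟩
  let g : ContDiffBump b := ⟨ε / 4, ε / 2, by positivity, by linarith⟩
  refine ⟨Metric.closedBall a (ε / 2) ×ˢ Metric.closedBall b (ε / 2), f, g,
    (isCompact_closedBall _ _).prod (isCompact_closedBall _ _), ?_, f.contDiff, g.contDiff,
    f.eventuallyEq_one, g.eventuallyEq_one, fun z hz => ?_⟩
  · rw [closedBall_prod_same]
    exact (Metric.closedBall_subset_ball (by linarith)).trans hball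
  · rw [mem_prod, not_and_or] at hz
    rcases hz with h | h
    · rw [Metric.mem_closedBall, not_le] at h
      rw [f.zero_of_le_dist h.le, zero_mul]
    · rw [Metric.mem_closedBall, not_le] at h
      rw [g.zero_of_le_dist h.le, mul_zero]

variable {E : Type*} [NormedAddCommGroup E] [NormedSpace ℝ E] [FiniteDimensional ℝ E]
  {F : Type*} [NormedAddCommGroup F] [NormedSpace ℝ F] [FiniteDimensional ℝ F]
  {M : Type*} [TopologicalSpace M] [T2Space M] [ChartedSpace E M] [IsManifold 𝓘(ℝ, E) ∞ M]
  {N : Type*} [TopologicalSpace N] [ChartedSpace F N] [IsManifold 𝓘(ℝ, F) ∞ N]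
  {ι : N → M} {ν : ∀ p : N, Submodule ℝ (Tan E (ι p))}

/-- Normal vectors extend to normal vector fields. -/
theorem exists_isNormalTo (hι : Manifold.IsSmoothEmbedding 𝓘(ℝ, F) 𝓘(ℝ, E) ∞ ι)
    (hν : IsNormalBundle F ι ν) {p : N} {w : Tan E (ι p)} (hw : w ∈ ν p) :
    ∃ X : ∀ x : M, Tan E x, IsNormalTo ν X ∧ X (ι p) = w := by
  classical
  have : IsManifold 𝓘(ℝ, E) 1 M := IsManifold.of_le (n := ∞) (by norm_cast)
  obtain ⟨r, T, hpT, hTs, hTi, hTν⟩ := exists_adapted_chart hι hν p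
  obtain ⟨K, χ, η, hK, hKT, hχ, hη, hχ1, hη1, h0⟩ :=
    exists_product_bump (a := (T (ι p)).1) (b := (T (ι p)).2) T.open_target (T.map_source hpT)
  let Tw : F × (Fin r → ℝ) := mfderiv 𝓘(ℝ, E) 𝓘(ℝ, F × (Fin r → ℝ)) T (ι p) w
  have hTw : Tw.1 = 0 := ((hTν p hpT).2 w).1 hw
  -- A multiple of a fixed vector without `s`-component, hence normal at every point of `N` in the
  -- chart.
  let W : F × (Fin r → ℝ) → F × (Fin r → ℝ) := fun z => (χ z.1 * η z.2) • Tw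
  have hW : ContDiff ℝ ∞ W :=
    ((hχ.comp contDiff_fst).mul (hη.comp contDiff_snd)).smul contDiff_const
  let X : ∀ x : M, Tan E x := fun x => if x ∈ T.source then
    (mfderiv 𝓘(ℝ, E) 𝓘(ℝ, F × (Fin r → ℝ)) T x).inverse (W (T x)) else 0
  have hX : ∀ x ∈ T.source, X x =
      (mfderiv 𝓘(ℝ, E) 𝓘(ℝ, F × (Fin r → ℝ)) T x).inverse (W (T x)) := fun x hx => if_pos hx
  have hX0 : ∀ x ∉ T.source, X x = 0 := fun x hx => if_neg hx
  refine ⟨X, ⟨fun x => ?_, fun q => ?_⟩, ?_⟩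
  · by_cases hx : x ∈ T.source
    · have h1 := ContMDiffAt.mpullback_vectorField_preimage (I := 𝓘(ℝ, E))
        (I' := 𝓘(ℝ, F × (Fin r → ℝ))) (f := T) (x₀ := x) (V := W) (m := ∞) (n := ∞)
        ((contMDiff_vectorSpace_iff_contDiff (V := W)).2 hW _)
        (hTs.contMDiffAt (T.open_source.mem_nhds hx)) (hTi x hx) (by rfl)
      refine h1.congr_of_eventuallyEq ?_
      filter_upwards [T.open_source.mem_nhds hx] with y hy
      rw [hX y hy]
      rfl
    · have h1 := Bundle.contMDiff_zeroSection (n := ∞) (F := E) (IB := 𝓘(ℝ, E)) ℝ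
        (TangentSpace 𝓘(ℝ, E) : M → Type _) x
      refine h1.congr_of_eventuallyEq ?_
      filter_upwards [eventually_notMem_of_notMem_source T hK hKT hx] with y hy
      by_cases hys : y ∈ T.source
      · rw [hX y hys]
        simp only [W]
        rw [h0 _ (hy hys), zero_smul]
        refine congrArg (Bundle.TotalSpace.mk y) ?_
        exact map_zero (mfderiv 𝓘(ℝ, E) 𝓘(ℝ, F × (Fin r → ℝ)) T y).inverse
      · rw [hX0 y hys]
        rfl
  · by_cases hq : ι q ∈ T.source
    · rw [(hTν q hq).2, hX _ hq]
      obtain ⟨e, he⟩ := hTi _ hq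
      rw [← he, ContinuousLinearMap.inverse_equiv]
      have h1 : e (e.symm (W (T (ι q)))) = W (T (ι q)) := e.apply_symm_apply _
      refine (congrArg (fun z : F × (Fin r → ℝ) => z.1) h1).trans ?_
      simp only [W, Prod.smul_fst, hTw, smul_zero]
    · rw [hX0 _ hq]
      exact zero_mem _
  · rw [hX _ hpT]
    have h1 : W (T (ι p)) = Tw := by
      simp only [W, hχ1.self_of_nhds, hη1.self_of_nhds, Pi.one_apply, mul_one, one_smul]
    rw [h1]
    obtain ⟨e, he⟩ := hTi _ hpT
    have h2 : Tw = e w := by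
      simp only [Tw]
      rw [← he]
      rfl
    rw [h2, ← he, ContinuousLinearMap.inverse_equiv]
    exact e.symm_apply_apply w

/-- Covectors annihilating `ν` are differentials of functions whose differentials annihilate `ν`
along `N`. -/
theorem exists_function_dAt_eq (hι : Manifold.IsSmoothEmbedding 𝓘(ℝ, F) 𝓘(ℝ, E) ∞ ι)
    (hν : IsNormalBundle F ι ν) {p : N} {α : Cotan E (ι p)} (hα : α ∈ annNormal ν p) :
    ∃ f : M → ℝ, ContMDiff 𝓘(ℝ, E) 𝓘(ℝ, ℝ) ∞ f ∧ (∀ q, dAt f (ι q) ∈ annNormal ν q) ∧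
      dAt f (ι p) = α := by
  classical
  have : IsManifold 𝓘(ℝ, E) 1 M := IsManifold.of_le (n := ∞) (by norm_cast)
  obtain ⟨r, T, hpT, hTs, hTi, hTν⟩ := exists_adapted_chart hι hν p
  obtain ⟨K, χ, η, hK, hKT, hχ, hη, hχ1, hη1, h0⟩ :=
    exists_product_bump (a := (T (ι p)).1) (b := (T (ι p)).2) T.open_target (T.map_source hpT)
  obtain ⟨e, he⟩ := hTi _ hpT
  let e' : E ≃L[ℝ] (F × (Fin r → ℝ)) := e
  let α' : E →L[ℝ] ℝ := α
  -- The covector `α` on the `s`-directions; nothing is lost, as the `c`-directions at `p` span `ν`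
  -- and `α` kills them.
  let ℓ : F →L[ℝ] ℝ := α' ∘L (e'.symm : F × (Fin r → ℝ) →L[ℝ] E) ∘L
    ContinuousLinearMap.inl ℝ F (Fin r → ℝ)
  let g : F → ℝ := fun s => ℓ s * χ s
  -- The cutoff has to be a product: `χ` depends on `s` alone and `η` is `1` near `c = 0`, so `dh`
  -- kills the `c`-directions along the whole slice and not merely near `p`.
  let h : F × (Fin r → ℝ) → ℝ := fun z => g z.1 * η z.2
  have hg : ContDiff ℝ ∞ g := ℓ.contDiff.mul hχ
  have hh : ContDiff ℝ ∞ h := (hg.comp contDiff_fst).mul (hη.comp contDiff_snd)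
  have hh0 : ∀ z ∉ K, h z = 0 := fun z hz => by
    simp only [h, g, mul_assoc, h0 z hz, mul_zero]
  have hη0 : η =ᶠ[𝓝 0] 1 := by rwa [(hTν p hpT).1] at hη1
  have hd : ∀ s : F, fderiv ℝ h (s, 0) = fderiv ℝ g s ∘L ContinuousLinearMap.fst ℝ F _ :=
    fun s => by
      have h1 : h =ᶠ[𝓝 (s, 0)] g ∘ Prod.fst := by
        have h2 : Filter.Tendsto (Prod.snd : F × (Fin r → ℝ) → _) (𝓝 (s, 0)) (𝓝 0) :=
          continuous_snd.tendsto (s, (0 : Fin r → ℝ))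
        filter_upwards [h2.eventually hη0] with z hz
        simp only [h, hz, Pi.one_apply, mul_one, Function.comp_apply]
      rw [h1.fderiv_eq]
      exact (HasFDerivAt.comp (s, (0 : Fin r → ℝ)) (f := Prod.fst) (g := g)
        ((hg.differentiable (by simp)) s).hasFDerivAt hasFDerivAt_fst).fderiv
  have hdg : fderiv ℝ g (T (ι p)).1 = ℓ := by
    have h1 : g =ᶠ[𝓝 (T (ι p)).1] ℓ := by
      filter_upwards [hχ1] with s hs
      simp only [g, hs, Pi.one_apply, mul_one]
    rw [h1.fderiv_eq, ContinuousLinearMap.fderiv]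
  let f : M → ℝ := fun x => if x ∈ T.source then h (T x) else 0
  have hf : ∀ x ∈ T.source, f =ᶠ[𝓝 x] h ∘ T := fun x hx => by
    filter_upwards [T.open_source.mem_nhds hx] with y hy
    exact if_pos hy
  have hf0 : ∀ x ∉ T.source, f =ᶠ[𝓝 x] fun _ => 0 := fun x hx => by
    filter_upwards [eventually_notMem_of_notMem_source T hK hKT hx] with y hy
    by_cases hys : y ∈ T.source
    · exact (if_pos hys).trans (hh0 _ (hy hys))
    · exact if_neg hys
  have hTd : ∀ x ∈ T.source, ContMDiffAt 𝓘(ℝ, E) 𝓘(ℝ, F × (Fin r → ℝ)) ∞ T x := fun x hx =>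
    hTs.contMDiffAt (T.open_source.mem_nhds hx)
  have hdf : ∀ q, ι q ∈ T.source → ∀ v : Tan E (ι q), dAt f (ι q) v =
      fderiv ℝ g (T (ι q)).1
        (show F × (Fin r → ℝ) from mfderiv 𝓘(ℝ, E) 𝓘(ℝ, F × (Fin r → ℝ)) T (ι q) v).1 :=
    fun q hq v => by
      have h1 : MDifferentiableAt 𝓘(ℝ, F × (Fin r → ℝ)) 𝓘(ℝ, ℝ) h (T (ι q)) :=
        ((hh.differentiable (by simp)) _).mdifferentiableAt
      have h2 := mfderiv_comp (ι q) h1 ((hTd _ hq).mdifferentiableAt (by simp))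
      rw [dAt, (hf _ hq).mfderiv_eq, h2, mfderiv_eq_fderiv]
      have h3 : T (ι q) = ((T (ι q)).1, 0) := Prod.ext rfl (hTν q hq).1
      have h4 : fderiv ℝ h (T (ι q)) =
          fderiv ℝ g (T (ι q)).1 ∘L ContinuousLinearMap.fst ℝ F _ := by
        rw [h3]
        exact hd _
      exact congrArg (fun L : F × (Fin r → ℝ) →L[ℝ] ℝ =>
        L (mfderiv 𝓘(ℝ, E) 𝓘(ℝ, F × (Fin r → ℝ)) T (ι q) v)) h4
  refine ⟨f, fun x => ?_, fun q w hw => ?_, ?_⟩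
  · by_cases hx : x ∈ T.source
    · exact ((hh.contMDiff _).comp x (hTd x hx)).congr_of_eventuallyEq (hf x hx)
    · exact contMDiffAt_const.congr_of_eventuallyEq (hf0 x hx)
  · by_cases hq : ι q ∈ T.source
    · rw [hdf q hq, ((hTν q hq).2 w).1 hw]
      exact map_zero _
    · rw [dAt, (hf0 _ hq).mfderiv_eq, mfderiv_const]
      rfl
  · ext v
    rw [hdf p hpT, hdg, ← he]
    change α (e.symm ((e' v).1, 0)) = α v
    have h1 : e.symm ((0 : F), (e' v).2) ∈ ν p := by
      rw [(hTν p hpT).2, ← he]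
      exact congrArg (fun z : F × (Fin r → ℝ) => z.1) (e.apply_symm_apply (0, (e' v).2))
    have h2 : v = e'.symm ((e' v).1, 0) + e'.symm (0, (e' v).2) := by
      rw [← map_add, Prod.mk_add_mk, add_zero, zero_add]
      exact (e'.symm_apply_apply v).symm
    have h3 : α v = α (e'.symm ((e' v).1, 0)) + α (e'.symm (0, (e' v).2)) :=
      (congrArg α' h2).trans (map_add α' _ _)
    rw [h3]
    have h4 : α (e'.symm (0, (e' v).2)) = 0 := hα _ h1
    rw [h4, add_zero]
    rfl

end Extension

end SolderedPoisson

namespace SolderedPoisson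

/-! ### Annihilators -/

section Annihilators

variable {E : Type*} [NormedAddCommGroup E] [NormedSpace ℝ E] [FiniteDimensional ℝ E]

/-- A subspace is the common kernel of its annihilator. Tangency and normality are both tested
against covectors in this way. -/
theorem mem_of_forall_annihilator (S : Submodule ℝ E) {v : E}
    (h : ∀ γ : E →L[ℝ] ℝ, (∀ t ∈ S, γ t = 0) → γ v = 0) : v ∈ S := by
  by_contra hv
  obtain ⟨f, hf, hS⟩ := Submodule.exists_le_ker_of_notMem hv
  exact hf (h (LinearMap.toContinuousLinearMap f) fun t ht => hS ht)

/-- The transposes of the two projections split the dual space; along `N` this is `T*M = ann ν ⊕ ann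
TN`. -/
theorem exists_annihilator_add {S T : Submodule ℝ E} (h : IsCompl S T) (α : E →L[ℝ] ℝ) :
    ∃ α₁ α₂ : E →L[ℝ] ℝ, α = α₁ + α₂ ∧ (∀ t ∈ T, α₁ t = 0) ∧ ∀ s ∈ S, α₂ s = 0 := by
  refine ⟨α ∘L LinearMap.toContinuousLinearMap (S.projection T h),
    α ∘L LinearMap.toContinuousLinearMap (T.projection S h.symm), ?_, fun t ht => ?_,
    fun s hs => ?_⟩
  · ext v
    change α v = α (S.projection T h v) + α (T.projection S h.symm v)
    rw [← map_add, Submodule.projection_add_projection_eq_self]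
  · change α (S.projection T h t) = 0
    rw [(Submodule.projection_apply_eq_zero_iff h).2 ht, map_zero]
  · change α (T.projection S h.symm s) = 0
    rw [(Submodule.projection_apply_eq_zero_iff h.symm).2 hs, map_zero]

end Annihilators

/-! ### The map `♯` along a Dirac submanifold -/

section Soldering

variable {E : Type*} [NormedAddCommGroup E] [NormedSpace ℝ E] [FiniteDimensional ℝ E]
  {F : Type*} [NormedAddCommGroup F] [NormedSpace ℝ F] [FiniteDimensional ℝ F]
  {M : Type*} [TopologicalSpace M] [T2Space M] [ChartedSpace E M] [IsManifold 𝓘(ℝ, E) ∞ M]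
  {N : Type*} [TopologicalSpace N] [ChartedSpace F N] [IsManifold 𝓘(ℝ, F) ∞ N]
  {ι : N → M} {ν : ∀ p : N, Submodule ℝ (Tan E (ι p))} {P : MVField E M 2} {k : ℕ}

theorem apply_sharp_swap (P : MVField E M 2) (x : M) (α β : Cotan E x) :
    β (sharp P x α) = -α (sharp P x β) :=
  apply_sharpFlat_swap (E := E) (P x) α β

/-- `♯` maps the annihilator of `TN` to `ν`. -/
theorem IsDirac.sharp_mem_normal (hD : IsDirac F P ι ν) {p : N} {γ : Cotan E (ι p)}
    (hγ : ∀ t ∈ tangentOf E F ι p, γ t = 0) : sharp P (ι p) γ ∈ ν p :=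
  mem_of_forall_annihilator (E := E) (ν p) fun β hβ => by
    refine (apply_sharp_swap P (ι p) γ β).trans ?_
    rw [hγ _ (hD.sharp_mem p β hβ), neg_zero]

/-- Split the preimage of `u` into parts in `ann ν` and `ann TN`. Their images lie in `TN` and `ν`;
since `u` is tangent, the normal image lies in `TN ∩ ν` and vanishes. -/
theorem exists_sharp_eq_of_mem_tangentOf (hν : IsNormalBundle F ι ν) (hD : IsDirac F P ι ν)
    (hP : ∀ x, (sharp P x).IsInvertible) {p : N} {u : Tan E (ι p)}
    (hu : u ∈ tangentOf E F ι p) : ∃ α ∈ annNormal ν p, sharp P (ι p) α = u := by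
  obtain ⟨e, he⟩ := hP (ι p)
  obtain ⟨α₁, α₂, h12, h1, h2⟩ := exists_annihilator_add (E := E) (hν.isCompl p) (e.symm u)
  have h3 : sharp P (ι p) α₁ + sharp P (ι p) α₂ = u := by
    refine (map_add (sharp P (ι p)) (show Cotan E (ι p) from α₁) α₂).symm.trans ?_
    rw [← he]
    exact (congrArg e h12.symm).trans (e.apply_symm_apply u)
  have h4 : sharp P (ι p) α₁ ∈ tangentOf E F ι p := hD.sharp_mem p α₁ h1
  have h5 : sharp P (ι p) α₂ ∈ ν p := hD.sharp_mem_normal h2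
  have h6 : sharp P (ι p) α₂ ∈ tangentOf E F ι p := by
    rw [← eq_sub_iff_add_eq'] at h3
    rw [h3]
    exact sub_mem hu h4
  have h7 : sharp P (ι p) α₂ = 0 := Submodule.disjoint_def.1 (hν.isCompl p).disjoint _ h6 h5
  exact ⟨α₁, h1, by rw [← h3, h7, add_zero]⟩

/-- The same splitting, where now the tangent image has to vanish. -/
theorem exists_sharp_eq_of_mem_normal (hν : IsNormalBundle F ι ν) (hD : IsDirac F P ι ν)
    (hP : ∀ x, (sharp P x).IsInvertible) {p : N} {w : Tan E (ι p)} (hw : w ∈ ν p) :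
    ∃ γ : Cotan E (ι p), (∀ t ∈ tangentOf E F ι p, γ t = 0) ∧ sharp P (ι p) γ = w := by
  obtain ⟨e, he⟩ := hP (ι p)
  obtain ⟨α₁, α₂, h12, h1, h2⟩ := exists_annihilator_add (E := E) (hν.isCompl p) (e.symm w)
  have h3 : sharp P (ι p) α₁ + sharp P (ι p) α₂ = w := by
    refine (map_add (sharp P (ι p)) (show Cotan E (ι p) from α₁) α₂).symm.trans ?_
    rw [← he]
    exact (congrArg e h12.symm).trans (e.apply_symm_apply w)
  have h4 : sharp P (ι p) α₁ ∈ tangentOf E F ι p := hD.sharp_mem p α₁ h1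
  have h5 : sharp P (ι p) α₂ ∈ ν p := hD.sharp_mem_normal h2
  have h6 : sharp P (ι p) α₁ ∈ ν p := by
    rw [← eq_sub_iff_add_eq] at h3
    rw [h3]
    exact sub_mem hw h5
  have h7 : sharp P (ι p) α₁ = 0 := Submodule.disjoint_def.1 (hν.isCompl p).disjoint _ h4 h6
  exact ⟨α₂, h2, by rw [← h3, h7, zero_add]⟩

/-! ### The bivector field of a Dirac submanifold is soldered -/

theorem dAt_eq_fderiv {f : M → ℝ} {G : E → ℝ} {x₀ z : M} (hz : z ∈ (chartAt E x₀).source)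
    (hG : DifferentiableAt ℝ G (extChartAt 𝓘(ℝ, E) x₀ z))
    (hf : f =ᶠ[𝓝 z] fun y => G (extChartAt 𝓘(ℝ, E) x₀ y)) (v : Tan E z) :
    dAt f z v = fderiv ℝ G (extChartAt 𝓘(ℝ, E) x₀ z) (chartDeriv x₀ z v) := by
  have : IsManifold 𝓘(ℝ, E) 1 M := IsManifold.of_le (n := ∞) (by norm_cast)
  have h1 : MDifferentiableAt 𝓘(ℝ, E) 𝓘(ℝ, E) (extChartAt 𝓘(ℝ, E) x₀) z :=
    mdifferentiableAt_extChartAt hz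
  have h2 : HasMFDerivAt 𝓘(ℝ, E) 𝓘(ℝ, ℝ) f z
      (fderiv ℝ G (extChartAt 𝓘(ℝ, E) x₀ z) ∘L chartDeriv x₀ z) :=
    (hG.hasFDerivAt.hasMFDerivAt.comp z h1.hasMFDerivAt).congr_of_eventuallyEq hf
  rw [dAt, h2.mfderiv]
  rfl

/-- Coordinate expression of a function. -/
def functionInChart (f : M → ℝ) (x₀ : M) (y : E) : ℝ := f ((extChartAt 𝓘(ℝ, E) x₀).symm y)

theorem contDiffAt_functionInChart {f : M → ℝ} (hf : ContMDiff 𝓘(ℝ, E) 𝓘(ℝ, ℝ) ∞ f) {x₀ z : M}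
    (hz : z ∈ (chartAt E x₀).source) :
    ContDiffAt ℝ ∞ (functionInChart f x₀) (extChartAt 𝓘(ℝ, E) x₀ z) := by
  have h1 : ContMDiffOn 𝓘(ℝ, E) 𝓘(ℝ, ℝ) ∞ (functionInChart f x₀)
      (extChartAt 𝓘(ℝ, E) x₀).target := hf.comp_contMDiffOn (contMDiffOn_extChartAt_symm x₀)
  rw [contMDiffOn_iff_contDiffOn] at h1
  exact h1.contDiffAt ((isOpen_extChartAt_target x₀).mem_nhds
    ((extChartAt 𝓘(ℝ, E) x₀).map_source (by rwa [extChartAt_source])))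

theorem dAt_eq_fderiv_functionInChart {f : M → ℝ} (hf : ContMDiff 𝓘(ℝ, E) 𝓘(ℝ, ℝ) ∞ f) {x₀ z : M}
    (hz : z ∈ (chartAt E x₀).source) (v : Tan E z) :
    dAt f z v = fderiv ℝ (functionInChart f x₀) (extChartAt 𝓘(ℝ, E) x₀ z) (chartDeriv x₀ z v) := by
  refine dAt_eq_fderiv hz ((contDiffAt_functionInChart hf hz).differentiableAt (by simp)) ?_ v
  filter_upwards [(chartAt E x₀).open_source.mem_nhds hz] with y hy
  simp only [functionInChart, extChartAt_symm_left hy]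

/-- A function in a chart which vanishes along `N` has a differential vanishing on `TN`. -/
theorem fderiv_apply_tangent_eq_zero (hι : ContMDiff 𝓘(ℝ, F) 𝓘(ℝ, E) ∞ ι) {p : N} {u : E → ℝ}
    (hu : DifferentiableAt ℝ u (extChartAt 𝓘(ℝ, E) (ι p) (ι p)))
    (h0 : ∀ q : N, ι q ∈ (chartAt E (ι p)).source → u (extChartAt 𝓘(ℝ, E) (ι p) (ι q)) = 0)
    {t : Tan E (ι p)} (ht : t ∈ tangentOf E F ι p) :
    fderiv ℝ u (extChartAt 𝓘(ℝ, E) (ι p) (ι p)) (chartDeriv (ι p) (ι p) t) = 0 := by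
  obtain ⟨w, rfl⟩ := ht
  have hp := mem_chart_source F p
  have hx := mem_chart_source E (ι p)
  have hjp : mapInChart ι p (ι p) (extChartAt 𝓘(ℝ, F) p p) = extChartAt 𝓘(ℝ, E) (ι p) (ι p) := by
    rw [mapInChart, extChartAt_symm_left hp]
  have hj := (contDiffAt_mapInChart (E := E) hι hp hx).differentiableAt (by simp)
  have h1 : u ∘ mapInChart ι p (ι p) =ᶠ[𝓝 (extChartAt 𝓘(ℝ, F) p p)] fun _ => (0 : ℝ) := by
    filter_upwards [(isOpen_chartPreimage hι.continuous p
      (chartAt E (ι p)).open_source).mem_nhds (mem_chartPreimage hp hx)] with s hs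
    exact h0 _ hs.2
  rw [← hjp] at hu ⊢
  have h2 := fderiv_comp _ hu hj
  rw [h1.fderiv_eq, fderiv_fun_const] at h2
  have h3 := congrArg (fun L : F →L[ℝ] ℝ => L (chartDeriv p p w)) h2
  change (0 : ℝ) = fderiv ℝ u _ (fderiv ℝ (mapInChart ι p (ι p)) _ (chartDeriv p p w)) at h3
  rw [fderiv_mapInChart hι hp hx] at h3
  exact h3.symm

theorem mvInChart_pair {x₀ z : M} (hz : z ∈ (chartAt E x₀).source) (P : MVField E M 2)
    (α β : E →L[ℝ] ℝ) : MVField.inChart P x₀ (extChartAt 𝓘(ℝ, E) x₀ z) ![α, β] =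
      P z ![α ∘L chartDeriv x₀ z, β ∘L chartDeriv x₀ z] := by
  rw [mvInChart_extChartAt _ hz, ContinuousAlternatingMap.compContinuousLinearMap_apply]
  congr 1
  funext i
  fin_cases i <;> rfl

/-- `L_X P` vanishes on the annihilator of `ν`, for normal vector fields `X`. -/
theorem IsDirac.lieDerivFlat_eq_zero (hι : Manifold.IsSmoothEmbedding 𝓘(ℝ, F) 𝓘(ℝ, E) ∞ ι)
    (hν : IsNormalBundle F ι ν) (hP : MVField.IsSmooth P) (hD : IsDirac F P ι ν)
    {X : ∀ x : M, Tan E x} (hX : IsNormalTo ν X) {p : N} {α β : Cotan E (ι p)}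
    (hα : α ∈ annNormal ν p) (hβ : β ∈ annNormal ν p) :
    lieDerivFlat (vectorInChart X (ι p)) (MVField.inChart P (ι p))
      (extChartAt 𝓘(ℝ, E) (ι p) (ι p))
      ![α ∘L (chartDeriv (ι p) (ι p)).inverse, β ∘L (chartDeriv (ι p) (ι p)).inverse] = 0 := by
  obtain ⟨f, hf, hfν, hfp⟩ := exists_function_dAt_eq hι hν hα
  obtain ⟨g, hg, hgν, hgp⟩ := exists_function_dAt_eq hι hν hβ
  set x := ι p with hxdef
  have hx : x ∈ (chartAt E x).source := mem_chart_source E x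
  set y₀ := extChartAt 𝓘(ℝ, E) x x with hy₀
  set f' := functionInChart (E := E) f x with hf'
  set g' := functionInChart (E := E) g x with hg'
  have hP' := hP.differentiableAt x
  have hX' := hX.1.differentiableAt x
  have hdiff : ∀ {f : M → ℝ}, ContMDiff 𝓘(ℝ, E) 𝓘(ℝ, ℝ) ∞ f →
      DifferentiableAt ℝ (fderiv ℝ (functionInChart (E := E) f x)) y₀ := fun hf =>
    ((contDiffAt_functionInChart hf hx).fderiv_right (m := 1) (by norm_cast)).differentiableAt
      (by simp)
  have hcov : ∀ {f : M → ℝ}, ContMDiff 𝓘(ℝ, E) 𝓘(ℝ, ℝ) ∞ f → ∀ z ∈ (chartAt E x).source,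
      fderiv ℝ (functionInChart (E := E) f x) (extChartAt 𝓘(ℝ, E) x z) ∘L chartDeriv x z =
        dAt f z := fun hf z hz => by
    ext v
    exact (dAt_eq_fderiv_functionInChart hf hz v).symm
  have hcov' : ∀ {f : M → ℝ}, ContMDiff 𝓘(ℝ, E) 𝓘(ℝ, ℝ) ∞ f →
      fderiv ℝ (functionInChart (E := E) f x) y₀ = dAt f x ∘L (chartDeriv x x).inverse :=
    fun hf => by
      ext v
      rw [← hcov hf x hx]
      exact congrArg _ (chartDeriv_apply_inverse hx v).symm
  -- Here `X{f, g} = (L_X P)(df, dg) + P(d(Xf), dg) + P(df, d(Xg))`; every term other than `(L_X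
  -- P)(df, dg)` is shown to vanish at `p`.
  have key := fderiv_apply_fderiv_fderiv hP' (contDiffAt_functionInChart hf hx)
    (contDiffAt_functionInChart hg hx) hX'
  have hlhs : fderiv ℝ (fun z => MVField.inChart P x z ![fderiv ℝ f' z, fderiv ℝ g' z]) y₀
      (vectorInChart X x y₀) = 0 := by
    obtain ⟨U, hU, hpU, hbr⟩ := hD.bracket p
    have h1 := hbr f g hf.contMDiffOn hg.contMDiffOn (fun q _ => hfν q) (fun q _ => hgν q) p hpU
      (X x) (hX.2 p)
    rw [vectorInChart_extChartAt X hx]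
    refine (dAt_eq_fderiv hx ?_ ?_ (X x)).symm.trans h1
    · have h2 : (fun z => MVField.inChart P x z ![fderiv ℝ f' z, fderiv ℝ g' z]) =
          fun z => MVField.inChart P x z fun i => (![fderiv ℝ f', fderiv ℝ g'] i) z := by
        funext z
        congr 1
        funext i
        fin_cases i <;> rfl
      rw [h2]
      refine hP'.continuousAlternatingMap_apply fun i => ?_
      fin_cases i
      · exact hdiff hf
      · exact hdiff hg
    · filter_upwards [(chartAt E x).open_source.mem_nhds hx] with z hz
      rw [poissonBracket, mvInChart_pair hz, hcov hf z hz, hcov hg z hz]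
  -- `Xf` vanishes on `N` because `X` is normal and `df` kills `ν` there, so `d(Xf)` kills `TN`.
  have hvan : ∀ {f : M → ℝ}, ContMDiff 𝓘(ℝ, E) 𝓘(ℝ, ℝ) ∞ f →
      (∀ q, dAt f (ι q) ∈ annNormal ν q) → ∀ t ∈ tangentOf E F ι p,
      fderiv ℝ (fun z => fderiv ℝ (functionInChart (E := E) f x) z (vectorInChart X x z)) y₀
        (chartDeriv x x t) = 0 := fun {f} hf hfν t ht => by
    refine fderiv_apply_tangent_eq_zero (p := p) hι.contMDiff ((hdiff hf).clm_apply hX')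
      (fun q hq => ?_) ht
    rw [vectorInChart_extChartAt X hq]
    exact (dAt_eq_fderiv_functionInChart hf hq _).symm.trans (hfν q _ (hX.2 q))
  -- `♯` sends a covector killing `TN` into `ν`, where a covector in `ann ν` vanishes.
  have hzero : ∀ (γ δ : E →L[ℝ] ℝ), (∀ t ∈ tangentOf E F ι p, γ (chartDeriv x x t) = 0) →
      δ ∘L chartDeriv x x ∈ annNormal ν p → MVField.inChart P x y₀ ![γ, δ] = 0 :=
    fun γ δ hγ hδ => by
      rw [mvInChart_pair hx, ← apply_sharp]
      exact hδ _ (hD.sharp_mem_normal hγ)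
  rw [hlhs, bivector_swap (MVField.inChart P x _) _ (fderiv ℝ (fun z => fderiv ℝ
    (functionInChart (E := E) g x) z (vectorInChart X x z)) _),
    hzero _ _ (hvan hf hfν) (by rw [hcov hg x hx]; exact hgν p),
    hzero _ _ (hvan hg hgν) (by rw [hcov hf x hx]; exact hfν p), hcov' hf, hcov' hg, hfp, hgp]
    at key
  linarith

end Soldering

end SolderedPoisson

namespace SolderedPoisson

section Soldering

variable {E : Type*} [NormedAddCommGroup E] [NormedSpace ℝ E] [FiniteDimensional ℝ E]
  {F : Type*} [NormedAddCommGroup F] [NormedSpace ℝ F] [FiniteDimensional ℝ F]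
  {M : Type*} [TopologicalSpace M] [T2Space M] [ChartedSpace E M] [IsManifold 𝓘(ℝ, E) ∞ M]
  {N : Type*} [TopologicalSpace N] [ChartedSpace F N] [IsManifold 𝓘(ℝ, F) ∞ N]
  {ι : N → M} {ν : ∀ p : N, Submodule ℝ (Tan E (ι p))} {P : MVField E M 2} {k : ℕ}

/-! ### Soldered forms, pointwise -/

variable (F) in
/-- Along `N`, the form vanishes on tangent vectors of `N` with one of them replaced by a
normal vector. -/
def VanishesOnNormal (ν : ∀ p : N, Submodule ℝ (Tan E (ι p))) (κ : DForm E M k) : Prop :=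
  ∀ (p : N) (u : Fin k → Tan E (ι p)), (∀ i, u i ∈ tangentOf E F ι p) →
    ∀ (i : Fin k), ∀ w ∈ ν p, κ (ι p) (Function.update u i w) = 0

/-- Alternation moves the normal vector to the first slot at the cost of a sign. -/
theorem vanishesOnNormal_succ_iff {κ : DForm E M (k + 1)} : VanishesOnNormal F ν κ ↔
    ∀ (p : N) (u : Fin k → Tan E (ι p)), (∀ i, u i ∈ tangentOf E F ι p) →
      ∀ w ∈ ν p, κ (ι p) (Matrix.vecCons w u) = 0 := by
  refine ⟨fun h p u hu w hw => ?_, fun h p u hu i w hw => ?_⟩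
  · have h1 := h p (Matrix.vecCons 0 u)
      (fun i => Fin.cases (zero_mem (tangentOf E F ι p)) hu i) 0 w hw
    rwa [Matrix.vecCons, Fin.update_cons_zero] at h1
  · refine (map_update_eq_vecCons (V := E) (κ (ι p)) u i w).trans ?_
    exact mul_eq_zero_of_right _ (h p (i.removeNth u) (fun j => hu _) w hw)

/-- Each normal vector at a point is the value of a normal vector field (`exists_isNormalTo`), so
the condition on fields is pointwise. -/
theorem contract_comp_eq_zero_iff (hι : Manifold.IsSmoothEmbedding 𝓘(ℝ, F) 𝓘(ℝ, E) ∞ ι)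
    (hν : IsNormalBundle F ι ν) (κ : DForm E M k) :
    (∀ X : ∀ x : M, Tan E x, IsNormalTo ν X → ∀ p : N,
      (contract (X (ι p)) (κ (ι p))).compLinearMap (diffAt E F ι p).toLinearMap = 0) ↔
    VanishesOnNormal F ν κ := by
  cases k with
  | zero => exact ⟨fun _ p u hu i => i.elim0, fun _ X _ p => rfl⟩
  | succ k =>
    rw [vanishesOnNormal_succ_iff]
    refine ⟨fun h p u hu w hw => ?_, fun h X hX p => ?_⟩
    · obtain ⟨X, hX, rfl⟩ := exists_isNormalTo hι hν hw
      choose t ht using hu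
      have h1 := congrArg (fun f => f t) (h X hX p)
      have h2 : u = fun i => diffAt E F ι p (t i) := funext fun i => (ht i).symm
      rw [h2]
      exact h1
    · ext t
      exact h p (fun i => diffAt E F ι p (t i)) (fun i => ⟨t i, rfl⟩) _ (hX.2 p)

/-- Along `N`, the Lie derivative of a form along a normal vector field is `i(X)dκ` on tangent
vectors of `N`, as `i(X)κ` vanishes there. -/
theorem lieFormFlat_eq_extD (hι : ContMDiff 𝓘(ℝ, F) 𝓘(ℝ, E) ∞ ι) {κ : DForm E M k}
    (hκ : DForm.IsSmooth κ) (hV : VanishesOnNormal F ν κ) {X : ∀ x : M, Tan E x}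
    (hX : IsNormalTo ν X) {p : N} {u : Fin k → Tan E (ι p)}
    (hu : ∀ i, u i ∈ tangentOf E F ι p) :
    lieFormFlat (vectorInChart X (ι p)) (DForm.inChart κ (ι p))
      (extChartAt 𝓘(ℝ, E) (ι p) (ι p)) (fun i => chartDeriv (ι p) (ι p) (u i)) =
    extD κ (ι p) (Matrix.vecCons (X (ι p)) u) := by
  have hx := mem_chart_source E (ι p)
  have hp := mem_chart_source F p
  have hext : extDeriv (DForm.inChart κ (ι p)) (extChartAt 𝓘(ℝ, E) (ι p) (ι p))
      (Matrix.vecCons (vectorInChart X (ι p) (extChartAt 𝓘(ℝ, E) (ι p) (ι p)))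
        (fun i => chartDeriv (ι p) (ι p) (u i))) =
      extD κ (ι p) (Matrix.vecCons (X (ι p)) u) := by
    rw [vectorInChart_extChartAt X hx]
    refine congrArg (extDeriv (DForm.inChart κ (ι p)) _) (funext fun i => ?_)
    exact Fin.cases rfl (fun _ => rfl) i
  cases k with
  | zero => rw [lieFormFlat_zero, hext]
  | succ k =>
    have hκd := hκ.differentiableAt (ι p)
    have hXd := hX.1.differentiableAt (ι p)
    rw [lieFormFlat_eq _ _ _ hXd hκd, hext]
    refine add_eq_left.2 ?_
    set θ : E → E [⋀^Fin k]→L[ℝ] ℝ := fun z =>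
      (DForm.inChart κ (ι p) z).curryLeft (vectorInChart X (ι p) z) with hθ
    set j : F → E := mapInChart ι p (ι p) with hj
    set s₀ := extChartAt 𝓘(ℝ, F) p p with hs₀
    have hjp : j s₀ = extChartAt 𝓘(ℝ, E) (ι p) (ι p) := by
      rw [hj, mapInChart, hs₀, extChartAt_symm_left hp]
    have hθd : DifferentiableAt ℝ θ (j s₀) := by
      rw [hjp]
      exact ((ContinuousAlternatingMap.curryLeftLI (𝕜 := ℝ) (E := E) (F := ℝ)
        (n := k)).toContinuousLinearMap.differentiableAt.comp _ hκd).clm_apply hXd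
    have hjs : ContDiffAt ℝ ∞ j s₀ := contDiffAt_mapInChart hι hp hx
    -- Pullback to `N` commutes with `d`, and the pullback of `i(X)κ` vanishes near the base point;
    -- so the second term of Cartan's formula is zero on vectors tangent to `N`.
    have hpull := extDeriv_pullback hθd hjs (by
      rw [minSmoothness_of_isRCLikeNormedField]
      norm_cast)
    have hzero : (fun s => (θ (j s)).compContinuousLinearMap (fderiv ℝ j s)) =ᶠ[𝓝 s₀]
        fun _ => 0 := by
      filter_upwards [(isOpen_chartPreimage hι.continuous p
        (chartAt E (ι p)).open_source).mem_nhds (mem_chartPreimage hp hx)] with s hs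
      obtain ⟨q, hq, rfl⟩ : ∃ q ∈ (chartAt F p).source, extChartAt 𝓘(ℝ, F) p q = s :=
        ⟨_, by simpa only [extChartAt_source] using (extChartAt 𝓘(ℝ, F) p).map_target hs.1,
          (extChartAt 𝓘(ℝ, F) p).right_inv hs.1⟩
      have hιq : ι q ∈ (chartAt E (ι p)).source := by
        have h1 := hs.2
        rwa [mem_preimage, extChartAt_symm_left hq] at h1
      have hjq : j (extChartAt 𝓘(ℝ, F) p q) = extChartAt 𝓘(ℝ, E) (ι p) (ι q) := by
        rw [hj, mapInChart, extChartAt_symm_left hq]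
      ext v
      have h1 : ∀ i, fderiv ℝ j (extChartAt 𝓘(ℝ, F) p q) (v i) = chartDeriv (ι p) (ι q)
          (diffAt E F ι q ((chartDeriv p q).inverse (v i))) := fun i => by
        rw [← fderiv_mapInChart hι hq hιq, chartDeriv_apply_inverse hq]
      have h2 := vanishesOnNormal_succ_iff.1 hV q
        (fun i => diffAt E F ι q ((chartDeriv p q).inverse (v i))) (fun i => ⟨_, rfl⟩) _ (hX.2 q)
      rw [apply_eq_inChart κ hιq] at h2
      refine Eq.trans ?_ h2
      rw [hjq]
      change DForm.inChart κ (ι p) _ (Matrix.vecCons _ fun i => fderiv ℝ j _ (v i)) = _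
      simp only [h1]
      rw [vectorInChart_extChartAt X hιq]
      refine congrArg (DForm.inChart κ (ι p) _) (funext fun i => ?_)
      exact Fin.cases rfl (fun _ => rfl) i
    rw [hzero.extDeriv_eq] at hpull
    choose t ht using hu
    have h3 : (fun i => (chartDeriv (ι p) (ι p) (u i) : E)) =
        fun i => fderiv ℝ j s₀ (chartDeriv p p (t i)) := funext fun i => by
      rw [hs₀, hj, fderiv_mapInChart hι hp hx, ← ht i]
      rfl
    have h4 := congrArg (fun f : F [⋀^Fin (k + 1)]→L[ℝ] ℝ => f fun i => chartDeriv p p (t i)) hpull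
    rw [h3, ← hjp]
    refine h4.symm.trans ?_
    simp [extDeriv, ContinuousAlternatingMap.alternatizeUncurryFin_apply]

/-- The link between the two derivative conditions of soldering: in the Leibniz formula for
`L_X(♯κ)` the Lie derivative of `κ` reduces to `i(X)dκ`, and the terms with `L_X P` drop out. -/
theorem lieDeriv_sharpForm_eq (hι : Manifold.IsSmoothEmbedding 𝓘(ℝ, F) 𝓘(ℝ, E) ∞ ι)
    (hν : IsNormalBundle F ι ν) (hP : MVField.IsSmooth P) (hD : IsDirac F P ι ν)
    {κ : DForm E M k} (hκ : DForm.IsSmooth κ) (hV : VanishesOnNormal F ν κ)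
    {X : ∀ x : M, Tan E x} (hX : IsNormalTo ν X) {p : N} {α : Fin k → Cotan E (ι p)}
    (hα : ∀ i, α i ∈ annNormal ν p) :
    lieDeriv X (sharpForm P κ) (ι p) α =
      (-1 : ℝ) ^ k * extD κ (ι p) (Matrix.vecCons (X (ι p)) fun i => sharp P (ι p) (α i)) := by
  have hx := mem_chart_source E (ι p)
  have hPd := hP.differentiableAt (ι p)
  have hs : ∀ i, sharp P (ι p) (α i) ∈ tangentOf E F ι p := fun i => hD.sharp_mem p _ (hα i)
  rw [lieDeriv_sharpForm, lieDerivFlat_sharpFormFlat hPd (hκ.differentiableAt _)]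
  simp only [← chartDeriv_sharp P hx]
  rw [lieFormFlat_eq_extD hι.contMDiff hκ hV hX hs, Finset.sum_eq_zero, add_zero]
  intro i _
  set w := lieSharpFlat (vectorInChart X (ι p)) (MVField.inChart P (ι p))
    (extChartAt 𝓘(ℝ, E) (ι p) (ι p)) (α i ∘L (chartDeriv (ι p) (ι p)).inverse) with hw
  -- The vector `(L_X P)(αᵢ, ·)` is killed by every covector in `ann ν`, hence is normal; `κ`
  -- vanishes when it is inserted among tangent vectors.
  have hwν : (chartDeriv (ι p) (ι p)).inverse w ∈ ν p :=
    mem_of_forall_annihilator (E := E) (ν p) fun β hβ =>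
      (apply_lieSharpFlat hPd _ _ (β ∘L (chartDeriv (ι p) (ι p)).inverse)).trans
        (hD.lieDerivFlat_eq_zero hι hν hP hX (hα i) hβ)
  refine Eq.trans ?_ (hV p _ hs i _ hwν)
  rw [apply_eq_inChart κ hx]
  refine congrArg (DForm.inChart κ (ι p) _) (funext fun l => ?_)
  rcases eq_or_ne l i with rfl | hl
  · simp only [Function.update_self]
    exact (chartDeriv_apply_inverse hx w).symm
  · simp only [Function.update_of_ne hl]

/-- The entry `0` is a placeholder overwritten by the update, which brings the value into the shape
of `VanishesOnNormal`. -/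
theorem sharpForm_snoc {κ : DForm E M (k + 1)} {x : M} (α : Fin k → Cotan E x) (β : Cotan E x) :
    sharpForm P κ x (Fin.snoc (α := fun _ => Cotan E x) α β) = (-1 : ℝ) ^ (k + 1) *
      κ x (Function.update (Fin.snoc (α := fun _ => Tan E x) (fun i => sharp P x (α i)) 0)
        (Fin.last k) (sharp P x β)) := by
  rw [Fin.update_snoc_last]
  refine congrArg (fun v => (-1 : ℝ) ^ (k + 1) * κ x v) (funext fun i => ?_)
  refine Fin.lastCases ?_ (fun i => ?_) i
  · simp
  · simp

/-- Tangency is tested on covectors `γ` killing `TN`: then `♯γ` is normal while the other arguments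
`♯αᵢ` are tangent, so `κ` vanishes. The derivative condition is `lieDeriv_sharpForm_eq`. -/
theorem IsSolderedForm.sharpForm (hι : Manifold.IsSmoothEmbedding 𝓘(ℝ, F) 𝓘(ℝ, E) ∞ ι)
    (hν : IsNormalBundle F ι ν) (hP : MVField.IsSmooth P) (hD : IsDirac F P ι ν)
    {κ : DForm E M k} (hκ : IsSolderedForm F ι ν κ) :
    IsSolderedMV F ι ν (SolderedPoisson.sharpForm P κ) where
  smooth := isSmooth_sharpForm hP hκ.smooth
  tangent := by
    have hV := (contract_comp_eq_zero_iff hι hν κ).1 hκ.contract_eq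
    cases k with
    | zero => trivial
    | succ k =>
      intro p α hα v hv
      refine mem_of_forall_annihilator (E := E) (tangentOf E F ι p) fun γ hγ => ?_
      refine (hv γ).trans ((sharpForm_snoc α γ).trans (mul_eq_zero_of_right _
        (hV p _ ?_ _ _ (hD.sharp_mem_normal hγ))))
      refine fun i => Fin.lastCases ?_ (fun i => ?_) i
      · rw [Fin.snoc_last]
        exact zero_mem _
      · rw [Fin.snoc_castSucc]
        exact hD.sharp_mem p _ (hα i)
  lieDeriv_eq := fun X hX p α hα => by
    rw [lieDeriv_sharpForm_eq hι hν hP hD hκ.smooth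
      ((contract_comp_eq_zero_iff hι hν κ).1 hκ.contract_eq) hX hα,
      vanishesOnNormal_succ_iff.1 ((contract_comp_eq_zero_iff hι hν (extD κ)).1
        hκ.contract_extD_eq) p _ (fun i => hD.sharp_mem p _ (hα i)) _ (hX.2 p), mul_zero]

/-- For invertible `♯` every tangent vector is `♯` of a covector in `ann ν`, and every normal one is
`♯` of a covector killing `TN`. Testing `♯κ` on such covectors therefore recovers all the conditions
on `κ` and `dκ`. -/
theorem IsSolderedMV.of_sharpForm (hι : Manifold.IsSmoothEmbedding 𝓘(ℝ, F) 𝓘(ℝ, E) ∞ ι)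
    (hν : IsNormalBundle F ι ν) (hP : MVField.IsSmooth P) (hD : IsDirac F P ι ν)
    (hinv : ∀ x, (sharp P x).IsInvertible) {κ : DForm E M k} (hκ : DForm.IsSmooth κ)
    (h : IsSolderedMV F ι ν (sharpForm P κ)) : IsSolderedForm F ι ν κ := by
  have hlift : ∀ {n : ℕ} {p : N} {u : Fin n → Tan E (ι p)}, (∀ i, u i ∈ tangentOf E F ι p) →
      ∃ α : Fin n → Cotan E (ι p), (∀ i, α i ∈ annNormal ν p) ∧
        u = fun i => sharp P (ι p) (α i) := fun hu => by
    choose α hα hαu using fun i => exists_sharp_eq_of_mem_tangentOf hν hD hinv (hu i)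
    exact ⟨α, hα, funext fun i => (hαu i).symm⟩
  have hV : VanishesOnNormal F ν κ := by
    have ht := h.tangent
    cases k with
    | zero => exact fun p u hu i => i.elim0
    | succ k =>
      refine vanishesOnNormal_succ_iff.2 fun p u hu w hw => ?_
      obtain ⟨α, hα, rfl⟩ := hlift hu
      obtain ⟨γ, hγ, rfl⟩ := exists_sharp_eq_of_mem_normal hν hD hinv hw
      obtain ⟨v, hv⟩ := exists_vector (sharpForm P κ (ι p)) α
      have h1 := (hv γ).symm.trans (hγ v (ht p α hα v hv))
      rw [sharpForm_snoc, Fin.update_snoc_last] at h1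
      have h2 := (mul_eq_zero.1 h1).resolve_left (pow_ne_zero _ (by norm_num))
      have h3 := (map_snoc_eq_vecCons (V := E) (κ (ι p)) (fun i => sharp P (ι p) (α i))
        (sharp P (ι p) γ)).symm.trans h2
      exact (mul_eq_zero.1 h3).resolve_left (pow_ne_zero _ (by norm_num))
  refine ⟨hκ, (contract_comp_eq_zero_iff hι hν κ).2 hV,
    (contract_comp_eq_zero_iff hι hν (extD κ)).2
      (vanishesOnNormal_succ_iff.2 fun p u hu w hw => ?_)⟩
  obtain ⟨α, hα, rfl⟩ := hlift hu
  obtain ⟨X, hX, rfl⟩ := exists_isNormalTo hι hν hw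
  have h1 := h.lieDeriv_eq X hX p α hα
  rw [lieDeriv_sharpForm_eq hι hν hP hD hκ hV hX hα] at h1
  exact (mul_eq_zero.1 h1).resolve_left (pow_ne_zero _ (by norm_num))

/-! ### The map in cohomology -/

theorem IsDefinedBy.isInvertible {Ω : DForm E M 2} (h : IsDefinedBy P Ω) (x : M) :
    (sharp P x).IsInvertible := by
  have hinj : Function.Injective (sharpFlat (E := E) (P x)).toLinearMap := by
    rw [injective_iff_map_eq_zero]
    intro α hα
    ext v
    have h1 := h x α v
    have h2 : Ω x ![sharp P x α, v] = 0 :=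
      (Ω x).map_coord_zero (m := ![sharp P x α, v]) 0 hα
    exact neg_eq_zero.1 (h1.symm.trans h2)
  have hfin : Module.finrank ℝ (E →L[ℝ] ℝ) = Module.finrank ℝ E :=
    (LinearEquiv.finrank_eq (LinearMap.toContinuousLinearMap (𝕜 := ℝ) (E := E)
      (F' := ℝ)).symm).trans Subspace.dual_finrank_eq
  exact ⟨(LinearEquiv.ofBijective (sharpFlat (E := E) (P x)).toLinearMap
    ⟨hinj, (LinearMap.injective_iff_surjective_of_finrank_eq_finrank hfin).1
      hinj⟩).toContinuousLinearEquiv, ContinuousLinearMap.ext fun _ => rfl⟩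

theorem sharpForm_mem_poissonCocycles (hι : Manifold.IsSmoothEmbedding 𝓘(ℝ, F) 𝓘(ℝ, E) ∞ ι)
    (hν : IsNormalBundle F ι ν) (hP : IsPoisson P) (hD : IsDirac F P ι ν)
    {κ : DForm E M k} (hκ : κ ∈ deRhamCocycles F ι ν k) :
    sharpForm P κ ∈ poissonCocycles F P ι ν k := by
  refine ⟨IsSolderedForm.sharpForm hι hν hP.smooth hD hκ.1, ?_⟩
  rw [poissonD_sharpForm hP hκ.1.smooth, hκ.2]
  funext x
  ext β
  simp [sharpForm]

variable (P k) in
/-- `sharpForm` as a linear map. -/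
def sharpFormₗ : DForm E M k →ₗ[ℝ] MVField E M k where
  toFun := sharpForm P
  map_add' κ κ' := by
    funext x
    ext β
    exact mul_add _ _ _
  map_smul' c κ := by
    funext x
    ext β
    exact mul_left_comm _ _ _

theorem sharpForm_mem_poissonCoboundaries (hι : Manifold.IsSmoothEmbedding 𝓘(ℝ, F) 𝓘(ℝ, E) ∞ ι)
    (hν : IsNormalBundle F ι ν) (hP : IsPoisson P) (hD : IsDirac F P ι ν)
    {κ : DForm E M k} (hκ : κ ∈ deRhamCoboundaries F ι ν k) :
    sharpForm P κ ∈ poissonCoboundaries F P ι ν k := by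
  cases k with
  | zero =>
    rw [(Submodule.mem_bot ℝ).1 hκ]
    exact (Submodule.mem_bot ℝ).2 (map_zero (sharpFormₗ P 0))
  | succ k =>
    obtain ⟨η, hη, rfl⟩ := hκ
    exact ⟨sharpForm P η, IsSolderedForm.sharpForm hι hν hP.smooth hD hη,
      poissonD_sharpForm hP hη.smooth⟩

theorem mem_deRhamCoboundaries_of_sharpForm
    (hι : Manifold.IsSmoothEmbedding 𝓘(ℝ, F) 𝓘(ℝ, E) ∞ ι)
    (hν : IsNormalBundle F ι ν) (hP : IsPoisson P) (hD : IsDirac F P ι ν)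
    (hinv : ∀ x, (sharp P x).IsInvertible) {κ : DForm E M k}
    (hκ : sharpForm P κ ∈ poissonCoboundaries F P ι ν k) : κ ∈ deRhamCoboundaries F ι ν k := by
  cases k with
  | zero =>
    refine (Submodule.mem_bot ℝ).2 (sharpForm_injective hinv ?_)
    exact ((Submodule.mem_bot ℝ).1 hκ).trans (map_zero (sharpFormₗ P 0)).symm
  | succ k =>
    obtain ⟨R, hR, hRκ⟩ := hκ
    have hs := isSmooth_sharpInvForm hP.smooth hinv hR.smooth
    have hR' := sharpForm_sharpInvForm hinv R
    refine ⟨sharpInvForm P R, IsSolderedMV.of_sharpForm hι hν hP.smooth hD hinv hs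
      (by rwa [hR']), sharpForm_injective hinv ?_⟩
    rw [← poissonD_sharpForm hP hs, hR', hRκ]

theorem exists_deRhamCocycle_sharpForm_eq
    (hι : Manifold.IsSmoothEmbedding 𝓘(ℝ, F) 𝓘(ℝ, E) ∞ ι)
    (hν : IsNormalBundle F ι ν) (hP : IsPoisson P) (hD : IsDirac F P ι ν)
    (hinv : ∀ x, (sharp P x).IsInvertible) {Q : MVField E M k}
    (hQ : Q ∈ poissonCocycles F P ι ν k) : ∃ κ ∈ deRhamCocycles F ι ν k, sharpForm P κ = Q := by
  have hs := isSmooth_sharpInvForm hP.smooth hinv hQ.1.smooth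
  have hQ' := sharpForm_sharpInvForm hinv Q
  refine ⟨sharpInvForm P Q, ⟨IsSolderedMV.of_sharpForm hι hν hP.smooth hD hinv hs
    (by rw [hQ']; exact hQ.1), sharpForm_injective hinv ?_⟩, hQ'⟩
  rw [← poissonD_sharpForm hP hs, hQ', hQ.2]
  exact (map_zero (sharpFormₗ P (k + 1))).symm

end Soldering

end SolderedPoisson

open SolderedPoisson in
theorem proposition2p7
    {E : Type*} [NormedAddCommGroup E] [NormedSpace ℝ E] [FiniteDimensional ℝ E]
    {M : Type*} [TopologicalSpace M] [T2Space M] [SecondCountableTopology M]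
    [ChartedSpace E M] [IsManifold 𝓘(ℝ, E) ∞ M]
    {F : Type*} [NormedAddCommGroup F] [NormedSpace ℝ F] [FiniteDimensional ℝ F]
    {N : Type*} [TopologicalSpace N] [ChartedSpace F N] [IsManifold 𝓘(ℝ, F) ∞ N]
    (P : MVField E M 2) (hP : IsPoisson P)
    (ι : N → M) (hι : Manifold.IsSmoothEmbedding 𝓘(ℝ, F) 𝓘(ℝ, E) ∞ ι)
    (ν : ∀ p : N, Submodule ℝ (Tan E (ι p))) (hν : IsNormalBundle F ι ν)
    (hD : IsDirac F P ι ν) (k : ℕ) :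
    ∃ f : SolderedDeRham F ι ν k →ₗ[ℝ] SolderedPoissonCohomology F P ι ν k,
      (∀ κ : deRhamCocycles F ι ν k, ∃ h : sharpForm P κ.1 ∈ poissonCocycles F P ι ν k,
        f (Submodule.Quotient.mk κ) = Submodule.Quotient.mk ⟨sharpForm P κ.1, h⟩) ∧
      ((∃ Ω : DForm E M 2, IsSymplectic Ω ∧ IsDefinedBy P Ω) → Function.Bijective f) := by
  let g : deRhamCocycles F ι ν k →ₗ[ℝ] poissonCocycles F P ι ν k :=
    (sharpFormₗ P k).restrict fun κ hκ => sharpForm_mem_poissonCocycles hι hν hP hD hκ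
  refine ⟨Submodule.mapQ _ _ g fun κ hκ => sharpForm_mem_poissonCoboundaries hι hν hP hD hκ,
    fun κ => ⟨(g κ).2, rfl⟩, ?_⟩
  rintro ⟨Ω, -, hΩ⟩
  constructor
  · rw [injective_iff_map_eq_zero]
    intro c
    obtain ⟨κ, rfl⟩ := Submodule.Quotient.mk_surjective _ c
    intro h
    exact (Submodule.Quotient.mk_eq_zero _).2
      (mem_deRhamCoboundaries_of_sharpForm hι hν hP hD hΩ.isInvertible
        ((Submodule.Quotient.mk_eq_zero _ (x := g κ)).1 h))
  · intro c
    obtain ⟨⟨Q, hQ⟩, rfl⟩ := Submodule.Quotient.mk_surjective _ c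
    obtain ⟨κ, hκ, rfl⟩ := exists_deRhamCocycle_sharpForm_eq hι hν hP hD hΩ.isInvertible hQ
    exact ⟨Submodule.Quotient.mk ⟨κ, hκ⟩, rfl⟩
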